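/- Let $X\subset\mathbb{CP}^3$ be a smooth irreducible closed algebraic curve that is not contained in a plane. For a point $O\in\mathbb{CP}^3$, a projection with centre $O$ is given by a $3\times4$ complex matrix $M$ whose kernel is exactly the line of $\mathbb C^4$ representing $O$; it sends a point $P\neq O$ to $MP\in\mathbb{CP}^2$. For a plane curve $Y\subset\mathbb{CP}^2$, the dual curve $Y^\star$ is the Zariski closure, in the dual plane, of the set of tangent lines to $Y$ at its smooth points. Lines of $\mathbb{CP}^2$ are identified with points $l$ of the dual plane by $l^Tw=0$. Then there is a non-empty Zariski open subset $U$ of $\mathbb{CP}^3\times\mathbb{CP}^3$, depending only on $X$, such that the following holds for every $(O_1,O_2)\in U$ and all projection matrices $M_1,M_2$ with centres $O_1,O_2$. Let $Y_i$ be the image of $X$ under $M_i$, and let $\phi_i$ be an equation of $Y_i^\star$, that is, a square-free homogeneous polynomial in three variables with zero locus $Y_i^\star$ ($i=1,2$). Let $\mathbf e_1\neq0$ be a vector representing the first epipole, the image of $O_2$ under $M_1$. Let $\mathbf F$ be the fundamental matrix of the pair, the $3\times3$ matrix with entries $$F_{ij}=\det\big(m^{(2)}_{i+1},\,m^{(2)}_{i+2},\,m^{(1)}_{j+1},\,m^{(1)}_{j+2}\big),$$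 where $m^{(k)}_1,m^{(k)}_2,m^{(k)}_3$ are the rows of $M_k$ and indices are taken modulo $3$; it sends a point $\mathbf p$ of the first plane, different from the epipole, to the line of the second plane that is the image under $M_2$ of the line in space projected by $M_1$ to $\mathbf p$. Then there is a non-zero scalar $\lambda\in\mathbb C$ such that $$\phi_2(\mathbf F\mathbf p)=\lambda\,\phi_1(\mathbf e_1\times\mathbf p)\qquad\text{for all }\mathbf p\in\mathbb C^3 .$$ -/

import Mathlib

open scoped Matrix LinearAlgebra.Projectivization Topology

namespace Kruppa

/-- Complex projective `n`-space. -/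
abbrev PP (n : ℕ) : Type := ℙ ℂ (Fin (n + 1) → ℂ)

/-- The zero locus of a homogeneous polynomial in projective space. -/
def hypersurface {n : ℕ} (f : MvPolynomial (Fin (n + 1)) ℂ) : Set (PP n) :=
  {P | MvPolynomial.eval P.rep f = 0}

/-- The Zariski topology on projective space: the complements of the hypersurfaces defined by
homogeneous polynomials form a basis of open sets. -/
instance zariski (n : ℕ) : TopologicalSpace (PP n) :=
  TopologicalSpace.generateFrom
    {U | ∃ (f : MvPolynomial (Fin (n + 1)) ℂ) (d : ℕ), f.IsHomogeneous d ∧ U = (hypersurface f)ᶜ}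

/-- The Zariski topology on `ℙ³ × ℙ³` (not the product topology): the non-vanishing loci of
bihomogeneous polynomials in two groups of four variables form a basis of open sets. -/
@[reducible] def zariskiProd : TopologicalSpace (PP 3 × PP 3) :=
  TopologicalSpace.generateFrom
    {U | ∃ (G : MvPolynomial (Fin 4 ⊕ Fin 4) ℂ) (a b : ℕ),
      MvPolynomial.IsWeightedHomogeneous (Sum.elim (fun _ => 1) (fun _ => 0) : _ → ℕ) G a ∧
      MvPolynomial.IsWeightedHomogeneous (Sum.elim (fun _ => 0) (fun _ => 1) : _ → ℕ) G b ∧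
      U = {O | MvPolynomial.eval (Sum.elim O.1.rep O.2.rep) G ≠ 0}}

/-- The affine cone over a subset of projective space, without its vertex. -/
def cone {n : ℕ} (X : Set (PP n)) : Set (Fin (n + 1) → ℂ) :=
  {v | ∃ h : v ≠ 0, Projectivization.mk ℂ v h ∈ X}

/-- The ideal of polynomials vanishing on a subset of projective space. -/
noncomputable def idealOf {n : ℕ} (X : Set (PP n)) : Ideal (MvPolynomial (Fin (n + 1)) ℂ) :=
  MvPolynomial.vanishingIdeal ℂ (cone X)

/-- The embedded projective tangent space of `X` at `P`, as a linear subspace of `ℂⁿ⁺¹`: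
the common kernel of the differentials at `P` of all polynomials that vanish on `X`. -/
noncomputable def tangentSpace {n : ℕ} (X : Set (PP n)) (P : PP n) :
    Submodule ℂ (Fin (n + 1) → ℂ) where
  carrier := {w | ∀ f ∈ idealOf X,
    ∑ i, MvPolynomial.eval P.rep (MvPolynomial.pderiv i f) * w i = 0}
  add_mem' := by
    intro a b ha hb f hf
    simp [mul_add, Finset.sum_add_distrib, ha f hf, hb f hf]
  zero_mem' := by
    intro f _
    simp
  smul_mem' := by
    intro c a ha f hf
    have h := congrArg (c * ·) (ha f hf)
    simp only [Finset.mul_sum, mul_zero] at h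
    rw [← h]
    exact Finset.sum_congr rfl fun i _ => by simp; ring

/-- `P` is a smooth point of the curve `X`: the tangent space is a projective line. -/
def IsSmoothPoint {n : ℕ} (X : Set (PP n)) (P : PP n) : Prop :=
  P ∈ X ∧ Module.finrank ℂ (tangentSpace X P) = 2

/-- A smooth irreducible closed algebraic curve in projective space. -/
structure IsSmoothIrreducibleCurve {n : ℕ} (X : Set (PP n)) : Prop where
  closed : IsClosed X
  irreducible : IsIrreducible X
  dim_one : topologicalKrullDim X = 1
  smooth : ∀ P ∈ X, IsSmoothPoint X P

/-- `X` is contained in a plane of `ℙ³`. -/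
def IsPlanar (X : Set (PP 3)) : Prop :=
  ∃ h : Fin 4 → ℂ, h ≠ 0 ∧ ∀ P ∈ X, h ⬝ᵥ P.rep = 0

/-- The matrix `M` presents a projection `ℙ³ ∖ {O} → ℙ²` with centre `O`: its kernel is exactly
the line of `ℂ⁴` that represents `O` (so `M` has rank three). -/
def IsProjectionFrom (M : Matrix (Fin 3) (Fin 4) ℂ) (O : PP 3) : Prop :=
  LinearMap.ker M.mulVecLin = O.submodule

/-- The image of `X` under the projection `P ↦ M P`. -/
def projectedCurve (M : Matrix (Fin 3) (Fin 4) ℂ) (X : Set (PP 3)) : Set (PP 2) :=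
  {Q | ∃ P ∈ X, ∃ h : M *ᵥ P.rep ≠ 0, Q = Projectivization.mk ℂ (M *ᵥ P.rep) h}

/-- The dual curve of a plane curve: the Zariski closure of the set of tangent lines at smooth
points. The line `{w | l ⬝ᵥ w = 0}` is the point `l` of the dual plane. -/
def dualCurve (Y : Set (PP 2)) : Set (PP 2) :=
  closure {l | ∃ P, IsSmoothPoint Y P ∧ ∀ w ∈ tangentSpace Y P, l.rep ⬝ᵥ w = 0}

/-- `φ` is the (reduced) equation of the plane curve `C`. -/
def IsEquationOf (φ : MvPolynomial (Fin 3) ℂ) (C : Set (PP 2)) : Prop :=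
  (∃ d : ℕ, φ.IsHomogeneous d) ∧ Squarefree φ ∧ C = hypersurface φ

/-- The fundamental matrix of the projections `M₁`, `M₂`. If `Γ, Λ, Θ` are the rows of `M₁`, the
optical ray of `p = (x, y, z)` is the extensor `x Λ ∧ Θ + y Θ ∧ Γ + z Γ ∧ Λ`; the `i`-th coordinate
of the image under `M₂` of a line is its pairing (wedge product, i.e. a `4 × 4` determinant) with
the meet of the rows `i + 1` and `i + 2` (indices modulo three) of `M₂`. -/
noncomputable def fundamentalMatrix (M₁ M₂ : Matrix (Fin 3) (Fin 4) ℂ) : Matrix (Fin 3) (Fin 3) ℂ :=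
  Matrix.of fun i j =>
    Matrix.det (Matrix.of ![M₂ (i + 1), M₂ (i + 2), M₁ (j + 1), M₁ (j + 2)])

/-- The vector `e` represents the epipole in the plane of `M`, the image under `M` of the other
centre `O`. -/
def IsEpipole (e : Fin 3 → ℂ) (M : Matrix (Fin 3) (Fin 4) ℂ) (O : PP 3) : Prop :=
  e ≠ 0 ∧ ∃ v ∈ O.submodule, e = M *ᵥ v

end Kruppa

/-!
Write `Nᵥ` for the conormal space at a point `v` of the cone over `X`. The union of all `Nᵥ` is the
cone over the dual variety of `X`; as `X` is not planar, it is an irreducible surface `Φ = 0`.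

A plane through a centre `O` is the pull-back `l ᵥ* M` of a line `l` of the image plane. If `O` lies
on no tangent line of `X`, then a line `l` is tangent to the projected curve `Y` exactly when the
plane `l ᵥ* M` is tangent to `X`, so the dual of `Y` is the section of `Φ = 0` by the planes through
`O`. Outside a discriminant hypersurface of centres that section is reduced, and the equation of the
dual of `Y` is, up to a constant, `Φ (l ᵥ* M)`.

Finally the epipolar lines `F p` and `e₁ × p` are the images of the same plane, spanned by the two
centres and the optical ray of `p`, so `(F p) ᵥ* M₂` is proportional to `(e₁ × p) ᵥ* M₁`, with a
factor that does not depend on `p`, and the homogeneity of `Φ` gives the identity.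
-/

namespace Kruppa

open MvPolynomial

section Polynomials

variable {σ : Type*} {R A B : Type*} [CommRing R] [CommRing A] [Algebra R A] [CommRing B]
  [Algebra R B]

theorem derivation_aeval [Fintype σ] {M : Type*} [AddCommGroup M] [Module A M] [Module R M]
    (D : Derivation R A M) (g : σ → A) (f : MvPolynomial σ R) :
    D (aeval g f) = ∑ i, aeval g (pderiv i f) • D (g i) := by
  classical
  induction f using MvPolynomial.induction_on with
  | C a => simp
  | add p q hp hq => simp only [map_add, hp, hq, add_smul, Finset.sum_add_distrib]
  | mul_X p i hp =>
    have hX : ∑ j, aeval g (pderiv j (X i : MvPolynomial σ R)) • D (g j) = D (g i) := by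
      rw [Finset.sum_eq_single i (fun j _ hj => by rw [pderiv_X_of_ne hj.symm, map_zero, zero_smul])
        (by simp), pderiv_X_self, map_one, one_smul]
    simp only [map_mul, aeval_X, Derivation.leibniz, hp, smul_eq_mul, map_add, add_smul,
      Finset.sum_add_distrib, Finset.smul_sum, mul_smul]
    rw [← hX, Finset.smul_sum]

theorem aeval_smul_of_isHomogeneous {f : MvPolynomial σ R} {d : ℕ} (hf : f.IsHomogeneous d)
    (c : A) (v : σ → A) : aeval (c • v) f = c ^ d * aeval v f := by
  classical
  simp only [aeval_def, eval₂_eq, Finset.mul_sum]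
  refine Finset.sum_congr rfl fun m hm => ?_
  have hd : ∑ i ∈ m.support, m i = d := (hf.degree_eq_sum_deg_support hm).symm
  simp only [Pi.smul_apply, smul_eq_mul, mul_pow, Finset.prod_mul_distrib,
    Finset.prod_pow_eq_pow_sum, hd]
  ring

theorem eval_smul_of_isHomogeneous {f : MvPolynomial σ R} {d : ℕ} (hf : f.IsHomogeneous d)
    (c : R) (v : σ → R) : eval (c • v) f = c ^ d * eval v f :=
  aeval_smul_of_isHomogeneous hf c v

/-- The restriction of a polynomial to the line `s ↦ u + s v`. The coordinates of `u` and `v` lie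
in an algebra `A` over the ring of coefficients, so that a family of lines, or the generic line, is
a line too. -/
noncomputable def restrictLine (u v : σ → A) : MvPolynomial σ R →ₐ[R] Polynomial A :=
  aeval fun i => Polynomial.C (u i) + Polynomial.C (v i) * Polynomial.X

theorem eval_restrictLine (u v : σ → A) (f : MvPolynomial σ R) (s : A) :
    (restrictLine u v f).eval s = aeval (u + s • v) f := by
  have h : ((Polynomial.aeval s).restrictScalars R).comp (restrictLine u v) =
      (aeval (u + s • v) : MvPolynomial σ R →ₐ[R] A) := by
    ext i
    simp [restrictLine, mul_comm s]
  rw [← h]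
  rfl

theorem map_restrictLine (φ : A →ₐ[R] B) (u v : σ → A) (f : MvPolynomial σ R) :
    (restrictLine u v f).map (φ : A →+* B) = restrictLine (φ ∘ u) (φ ∘ v) f := by
  have h : (Polynomial.mapAlgHom φ).comp (restrictLine u v) = restrictLine (φ ∘ u) (φ ∘ v) := by
    ext i : 1
    simp [restrictLine]
  rw [← h]
  rfl

theorem natDegree_restrictLine_le (u v : σ → A) (f : MvPolynomial σ R) :
    (restrictLine u v f).natDegree ≤ f.totalDegree := by
  classical
  have hlin i : (Polynomial.C (u i) + Polynomial.C (v i) * Polynomial.X).natDegree ≤ 1 := by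
    compute_degree
  rw [restrictLine, aeval_def, eval₂_eq]
  refine Polynomial.natDegree_sum_le_of_forall_le _ _ fun m hm => ?_
  rw [IsScalarTower.algebraMap_apply R A (Polynomial A), Polynomial.algebraMap_eq]
  refine (Polynomial.natDegree_C_mul_le _ _).trans <| (Polynomial.natDegree_prod_le _ _).trans <|
    (Finset.sum_le_sum fun i _ => ?_).trans (le_totalDegree hm)
  simpa using Polynomial.natDegree_pow_le_of_le (m i) (hlin i)

theorem coeff_prod_linear_pow (u v : σ → A) (m : σ → ℕ) (s : Finset σ) :
    (∏ i ∈ s, (Polynomial.C (u i) + Polynomial.C (v i) * Polynomial.X) ^ m i).coeff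
      (∑ i ∈ s, m i) = ∏ i ∈ s, v i ^ m i := by
  classical
  have hlin i : (Polynomial.C (u i) + Polynomial.C (v i) * Polynomial.X).natDegree ≤ 1 := by
    compute_degree
  have hpow i : ((Polynomial.C (u i) + Polynomial.C (v i) * Polynomial.X) ^ m i).natDegree ≤
      m i := by
    simpa using Polynomial.natDegree_pow_le_of_le (m i) (hlin i)
  have hcoeff i : ((Polynomial.C (u i) + Polynomial.C (v i) * Polynomial.X) ^ m i).coeff (m i) =
      v i ^ m i := by
    simpa using Polynomial.coeff_pow_of_natDegree_le (m := m i) (hlin i)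
  induction s using Finset.induction_on with
  | empty => simp
  | insert a s ha ih =>
    rw [Finset.prod_insert ha, Finset.sum_insert ha, Finset.prod_insert ha,
      Polynomial.coeff_mul_add_eq_of_natDegree_le (hpow a)
        ((Polynomial.natDegree_prod_le _ _).trans (Finset.sum_le_sum fun b _ => hpow b)), ih,
      hcoeff]

theorem coeff_restrictLine (u v : σ → A) {f : MvPolynomial σ R} {d : ℕ}
    (hf : f.IsHomogeneous d) : (restrictLine u v f).coeff d = aeval v f := by
  classical
  simp only [restrictLine, aeval_def, eval₂_eq, Polynomial.finsetSum_coeff,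
    IsScalarTower.algebraMap_apply R A (Polynomial A), Polynomial.algebraMap_eq,
    Polynomial.coeff_C_mul]
  refine Finset.sum_congr rfl fun m hm => ?_
  rw [hf.degree_eq_sum_deg_support hm, coeff_prod_linear_pow]

theorem derivative_restrictLine [Fintype σ] (u v : σ → A) (f : MvPolynomial σ R) :
    Polynomial.derivative (restrictLine u v f) =
      ∑ i, restrictLine u v (pderiv i f) * Polynomial.C (v i) := by
  have h := derivation_aeval ((Polynomial.derivative' (R := A)).restrictScalars R)
    (fun i => Polynomial.C (u i) + Polynomial.C (v i) * Polynomial.X) f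
  simpa [restrictLine] using h

theorem coeff_restrictLine_zero (v : σ → A) (f : MvPolynomial σ R) (j : ℕ) :
    (restrictLine 0 v f).coeff j = aeval v (homogeneousComponent j f) := by
  have hmonomial (k : ℕ) : restrictLine 0 v (homogeneousComponent k f) =
      Polynomial.C (aeval v (homogeneousComponent k f)) * Polynomial.X ^ k := by
    have h := aeval_smul_of_isHomogeneous (homogeneousComponent_isHomogeneous k f)
      (Polynomial.X : Polynomial A) (Polynomial.C ∘ v)
    have hC := aeval_algebraMap_apply (Polynomial A) v (homogeneousComponent k f)
    simp only [Polynomial.algebraMap_eq] at hC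
    rw [mul_comm, ← hC, ← h]
    simp only [restrictLine, Pi.zero_apply, map_zero, zero_add]
    congr 2
    ext1 i
    simp
  conv_lhs => rw [← sum_homogeneousComponent f, map_sum]
  simp only [hmonomial, Polynomial.finsetSum_coeff, Polynomial.coeff_C_mul_X_pow,
    Finset.sum_ite_eq, Finset.mem_range]
  split_ifs with h
  · rfl
  · rw [homogeneousComponent_eq_zero _ _ (by omega), map_zero]

end Polynomials

section VanishingIdeal

variable {σ K : Type*} [Field K]

theorem mem_vanishingIdeal_iff_eval {V : Set (σ → K)} {f : MvPolynomial σ K} :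
    f ∈ vanishingIdeal K V ↔ ∀ v ∈ V, eval v f = 0 := by
  simp only [mem_vanishingIdeal_iff, aeval_eq_eval]

theorem polynomial_eq_zero_of_forall_ne_zero [Infinite K] {p : Polynomial K}
    (h : ∀ c : K, c ≠ 0 → p.eval c = 0) : p = 0 :=
  Polynomial.eq_zero_of_infinite_isRoot p <|
    (Set.finite_singleton (0 : K)).infinite_compl.mono fun c hc => h c hc

theorem eval_homogeneousComponent_eq_zero [Infinite K] {f : MvPolynomial σ K} {v : σ → K}
    (h : ∀ c : K, c ≠ 0 → eval (c • v) f = 0) (j : ℕ) :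
    eval v (homogeneousComponent j f) = 0 := by
  have hline : restrictLine 0 v f = 0 := polynomial_eq_zero_of_forall_ne_zero fun c hc => by
    rw [eval_restrictLine, zero_add]
    exact h c hc
  have hcoeff := coeff_restrictLine_zero v f j
  rw [hline, Polynomial.coeff_zero] at hcoeff
  exact hcoeff.symm

/-- Stability under multiplication by non-zero scalars, as for the affine cone over a projective
set. The vertex may or may not belong to the set. -/
def IsConical (V : Set (σ → K)) : Prop := ∀ v ∈ V, ∀ c : K, c ≠ 0 → c • v ∈ V

attribute [local instance] MvPolynomial.gradedAlgebra

theorem isHomogeneous_vanishingIdeal [Infinite K] {V : Set (σ → K)}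
    (hV : IsConical V) :
    (vanishingIdeal K V).IsHomogeneous (homogeneousSubmodule σ K) := by
  intro j f hf
  rw [mem_vanishingIdeal_iff_eval] at hf ⊢
  intro v hv
  have hdec : (DirectSum.decompose (homogeneousSubmodule σ K) f j : MvPolynomial σ K) =
      homogeneousComponent j f := decomposition.decompose'_apply f j
  rw [hdec]
  exact eval_homogeneousComponent_eq_zero (fun c hc => hf _ (hV v hv c hc)) j

theorem isPrime_vanishingIdeal [Infinite K] {V : Set (σ → K)}
    (hV : IsConical V) (hne : V.Nonempty)
    (hmul : ∀ (f g : MvPolynomial σ K) (d e : ℕ), f.IsHomogeneous d → g.IsHomogeneous e →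
      f * g ∈ vanishingIdeal K V → f ∈ vanishingIdeal K V ∨ g ∈ vanishingIdeal K V) :
    (vanishingIdeal K V).IsPrime := by
  refine (isHomogeneous_vanishingIdeal hV).isPrime_of_homogeneous_mem_or_mem ?_ ?_
  · obtain ⟨v, hv⟩ := hne
    rw [Ideal.ne_top_iff_one, mem_vanishingIdeal_iff_eval]
    exact fun h => one_ne_zero (α := K) (by simpa using h v hv)
  · rintro f g ⟨d, hf⟩ ⟨e, hg⟩ hfg
    exact hmul f g d e hf hg hfg

theorem isHomogeneous_of_span_singleton {R : Type*} [CommRing R] [IsDomain R]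
    {Φ : MvPolynomial σ R}
    (h : (Ideal.span {Φ}).IsHomogeneous (homogeneousSubmodule σ R)) :
    Φ.IsHomogeneous Φ.totalDegree := by
  have hdvd (j : ℕ) : Φ ∣ homogeneousComponent j Φ := by
    have hdec : (DirectSum.decompose (homogeneousSubmodule σ R) Φ j : MvPolynomial σ R) =
        homogeneousComponent j Φ := decomposition.decompose'_apply Φ j
    exact Ideal.mem_span_singleton.1 (hdec ▸ h j (Ideal.mem_span_singleton_self Φ))
  have hzero (j : ℕ) (hj : j ≠ Φ.totalDegree) : homogeneousComponent j Φ = 0 := by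
    by_contra hne
    have hle := totalDegree_le_of_dvd_of_isDomain (hdvd j) hne
    rw [(homogeneousComponent_isHomogeneous j Φ).totalDegree hne] at hle
    exact hne (homogeneousComponent_eq_zero _ _ (lt_of_le_of_ne hle hj.symm))
  have hsum := sum_homogeneousComponent Φ
  rw [Finset.sum_eq_single_of_mem _ (Finset.self_mem_range_succ _)
    fun j _ hj => hzero j hj] at hsum
  have hhom := homogeneousComponent_isHomogeneous Φ.totalDegree Φ
  rwa [hsum] at hhom

end VanishingIdeal

section Gradient

variable {σ τ R : Type*} [CommRing R]

/-- The value at `v` of the gradient of a polynomial, that is, its differential at `v` written as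
a row vector. -/
noncomputable def gradient (v : σ → R) : MvPolynomial σ R →ₗ[R] σ → R where
  toFun f i := eval v (pderiv i f)
  map_add' f g := by ext i; simp
  map_smul' c f := by ext i; simp [smul_eval]

theorem gradient_apply (v : σ → R) (f : MvPolynomial σ R) (i : σ) :
    gradient v f i = eval v (pderiv i f) := rfl

/-- The value at `v` of a vector with polynomial entries. -/
noncomputable def evalField (v : σ → R) (W : τ → MvPolynomial σ R) : τ → R := fun i => eval v (W i)

theorem eval_evalField (v : σ → R) (W : τ → MvPolynomial σ R) (f : MvPolynomial τ R) :
    eval (evalField v W) f = eval v (aeval W f) := by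
  simp only [← aeval_eq_eval, aeval_eq_bind₁, aeval_bind₁]
  rfl

end Gradient

section Substitution

variable {m n R : Type*} [Fintype n] [CommRing R]

/-- The polynomial `v ↦ f (M v)`. -/
noncomputable def compMulVec (M : Matrix m n R) : MvPolynomial m R →ₐ[R] MvPolynomial n R :=
  aeval M.toMvPolynomial

theorem eval_compMulVec (M : Matrix m n R) (f : MvPolynomial m R) (v : n → R) :
    eval v (compMulVec M f) = eval (M *ᵥ v) f := by
  rw [compMulVec, ← eval_evalField]
  congr 2
  ext i
  exact M.toMvPolynomial_eval_eq_apply i v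

theorem isHomogeneous_compMulVec (M : Matrix m n R) {f : MvPolynomial m R} {d : ℕ}
    (hf : f.IsHomogeneous d) : (compMulVec M f).IsHomogeneous d := by
  simpa only [one_mul, compMulVec] using hf.aeval _ fun i => M.toMvPolynomial_isHomogeneous i

theorem pderiv_toMvPolynomial (M : Matrix m n R) (i : m) (j : n) :
    pderiv j (M.toMvPolynomial i) = C (M i j) := by
  classical
  simp only [Matrix.toMvPolynomial, map_sum, pderiv_monomial]
  rw [Finset.sum_eq_single_of_mem j (Finset.mem_univ j) fun k _ hk => ?_]
  · simp
  · simp [Finsupp.single_eq_of_ne' hk]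

theorem gradient_compMulVec [Fintype m] (M : Matrix m n R) (f : MvPolynomial m R) (v : n → R) :
    gradient v (compMulVec M f) = gradient (M *ᵥ v) f ᵥ* M := by
  ext j
  have h := congrArg (eval v) (derivation_aeval (pderiv j) M.toMvPolynomial f)
  simp only [pderiv_toMvPolynomial, map_sum, smul_eq_mul, map_mul, eval_C] at h
  rw [gradient_apply, compMulVec, h]
  refine Finset.sum_congr rfl fun i _ => ?_
  rw [gradient_apply, ← eval_compMulVec, compMulVec]

end Substitution

section Transcendence

open scoped KaehlerDifferential TensorProduct

universe u

theorem rank_kaehlerDifferential_eq_trdeg (K L : Type u) [Field K] [Field L] [Algebra K L]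
    [CharZero K] : Module.rank L Ω[L⁄K] = Algebra.trdeg K L := by
  obtain ⟨ι, x, hx⟩ := exists_isTranscendenceBasis' K L
  let P := MvPolynomial ι K
  let _ : Algebra P L := (aeval x).toAlgebra
  have : IsScalarTower K P L := .of_algHom (aeval x)
  have hinj : Function.Injective (algebraMap P L) := hx.1
  have : FaithfulSMul P L := (faithfulSMul_iff_algebraMap_injective P L).2 hinj
  have : Algebra.IsAlgebraic P L := by
    have := hx.isAlgebraic
    refine Algebra.IsAlgebraic.of_ringHom_of_comp_eq hx.1.aevalEquiv.toRingEquiv (RingHom.id L)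
      hx.1.aevalEquiv.surjective Function.injective_id ?_
    exact RingHom.ext hx.1.algebraMap_aevalEquiv
  let _ := FractionRing.liftAlgebra P L
  have : Algebra.IsAlgebraic (FractionRing P) L :=
    (IsFractionRing.comap_isAlgebraic_iff (A := P)).1 ‹_›
  have := charZero_of_injective_algebraMap (FaithfulSMul.algebraMap_injective K (FractionRing P))
  have : Algebra.FormallyEtale (FractionRing P) L := .of_isSeparable _ _
  have : Algebra.FormallyEtale P (FractionRing P) := .of_isLocalization (nonZeroDivisors P)
  have : Algebra.FormallyEtale P L := .comp P (FractionRing P) L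
  have hbasis := ((KaehlerDifferential.mvPolynomialBasis K ι).baseChange L).mk_eq_rank''
  rw [← (KaehlerDifferential.tensorKaehlerEquivOfFormallyEtale K P L).rank_eq,
    ← hx.cardinalMk_eq_trdeg, hbasis]

theorem exists_mul_eq_one_of_linearIndependent {κ ι K : Type*} [Finite κ] [Fintype ι]
    [DecidableEq κ] [Field K] {W : Matrix κ ι K} (hW : LinearIndependent K W.row) :
    ∃ L : Matrix ι κ K, W * L = 1 := by
  cases nonempty_fintype κ
  rw [← Matrix.mulVec_surjective_iff_exists_right_inverse]
  have hrank := hW.rank_matrix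
  rw [Matrix.rank, ← Module.finrank_fintype_fun_eq_card K] at hrank
  exact LinearMap.range_eq_top.1 (Submodule.eq_top_of_finrank_eq hrank)

theorem linearIndependent_row_map {κ ι K R L : Type*} [Finite κ] [Finite ι] [Field K]
    [CommRing R] [Algebra K R] [CommRing L] [IsDomain L] [Algebra K L] (φ : R →ₐ[K] K)
    (q : R →ₐ[K] L) (hq : ∀ r, q r = 0 → φ r = 0) {W : Matrix κ ι R}
    (hW : LinearIndependent K (W.map φ).row) : LinearIndependent L (W.map q).row := by
  classical
  cases nonempty_fintype κ
  cases nonempty_fintype ι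
  obtain ⟨N, hN⟩ := exists_mul_eq_one_of_linearIndependent hW
  let D := W * N.map (algebraMap K R)
  have hφ : D.map φ = 1 := by
    have hNφ : (N.map (algebraMap K R)).map φ = N := by ext; simp
    rw [Matrix.map_mul, hNφ, hN]
  have hdet : (D.map q).det ≠ 0 := by
    have hφdet : φ D.det = 1 := by
      rw [AlgHom.map_det, AlgHom.mapMatrix_apply, hφ, Matrix.det_one]
    rw [← AlgHom.mapMatrix_apply, ← AlgHom.map_det]
    exact fun h => one_ne_zero (hφdet.symm.trans (hq _ h))
  have hD : LinearIndependent L (D.map q).row := Matrix.linearIndependent_rows_of_det_ne_zero hdet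
  rw [← Matrix.vecMul_injective_iff] at hD ⊢
  refine fun a b hab => hD ?_
  simp only [D, Matrix.map_mul, ← Matrix.vecMul_vecMul] at hab ⊢
  rw [hab]

/-- The derivative of a relation between the `x i` is a relation between their differentials, and
the rank of the module of differentials is the transcendence degree. -/
theorem trdeg_add_card_le {K L σ : Type u} {κ : Type*} [Field K] [CharZero K] [Field L]
    [Algebra K L] [Fintype σ] [Fintype κ] {x : σ → L}
    (hx : Submodule.span L (Set.range fun i => KaehlerDifferential.D K L (x i)) = ⊤)
    {f : κ → MvPolynomial σ K} (hf : ∀ j, aeval x (f j) = 0)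
    (hind : LinearIndependent L fun j i => aeval x (pderiv i (f j))) :
    Algebra.trdeg K L + Fintype.card κ ≤ Fintype.card σ := by
  let δ := Fintype.linearCombination L fun i => KaehlerDifferential.D K L (x i)
  have hδ : LinearMap.range δ = ⊤ := (Fintype.range_linearCombination ..).trans hx
  have hker j : (fun i => aeval x (pderiv i (f j))) ∈ LinearMap.ker δ := by
    rw [LinearMap.mem_ker, Fintype.linearCombination_apply, ← derivation_aeval, hf, map_zero]
  have hind' : LinearIndependent L fun j => (⟨_, hker j⟩ : LinearMap.ker δ) :=
    .of_comp (LinearMap.ker δ).subtype hind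
  have hle := hind'.cardinal_lift_le_rank
  have hrank := LinearMap.rank_range_add_rank_ker δ
  rw [hδ, rank_top, rank_kaehlerDifferential_eq_trdeg, rank_fun'] at hrank
  rw [← hrank]
  simp only [Cardinal.mk_fintype, Cardinal.lift_natCast] at hle
  gcongr
  simpa using hle

section Quotient

variable {σ K : Type u} [Field K] (I : Ideal (MvPolynomial σ K))

theorem aeval_mk_X (f : MvPolynomial σ K) :
    aeval (fun i => Ideal.Quotient.mk I (X i)) f = Ideal.Quotient.mk I f := by
  rw [← Ideal.Quotient.mkₐ_eq_mk K, ← comp_aeval_apply, aeval_X_left_apply]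

/-- The function field of the variety defined by a prime ideal. -/
abbrev FunctionField : Type u := FractionRing (MvPolynomial σ K ⧸ I)

/-- The coordinate functions of the variety defined by a prime ideal, as elements of its function
field. -/
noncomputable def coordinate (i : σ) : FunctionField I :=
  algebraMap (MvPolynomial σ K ⧸ I) _ (Ideal.Quotient.mk I (X i))

theorem aeval_coordinate (f : MvPolynomial σ K) :
    aeval (coordinate I) f = algebraMap _ (FunctionField I) (Ideal.Quotient.mk I f) := by
  rw [← aeval_mk_X, ← aeval_algebraMap_apply]
  rfl

theorem aeval_coordinate_eq_zero_iff [I.IsPrime] {f : MvPolynomial σ K} :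
    aeval (coordinate I) f = 0 ↔ f ∈ I := by
  rw [aeval_coordinate, FaithfulSMul.algebraMap_eq_zero_iff, Ideal.Quotient.eq_zero_iff_mem]

theorem span_range_D_coordinate [Finite σ] : Submodule.span (FunctionField I)
    (Set.range fun i => KaehlerDifferential.D K (FunctionField I) (coordinate I i)) = ⊤ := by
  cases nonempty_fintype σ
  rw [eq_top_iff, ← KaehlerDifferential.span_range_map_derivation_of_isLocalization K
    (MvPolynomial σ K ⧸ I) _ (nonZeroDivisors _), Submodule.span_le]
  rintro _ ⟨a, rfl⟩
  obtain ⟨f, rfl⟩ := Ideal.Quotient.mk_surjective a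
  rw [Function.comp_apply, KaehlerDifferential.map_D, ← aeval_coordinate, derivation_aeval]
  exact Submodule.sum_mem _ fun i _ => Submodule.smul_mem _ _ (Submodule.subset_span ⟨i, rfl⟩)

variable {I} in
theorem trdeg_add_finrank_gradient_le [I.IsPrime] [Fintype σ] [CharZero K] {v : σ → K}
    (hv : ∀ f ∈ I, eval v f = 0) :
    Algebra.trdeg K (MvPolynomial σ K ⧸ I) +
      Module.finrank K ((I.restrictScalars K).map (gradient v)) ≤ Fintype.card σ := by
  let b := Module.finBasis K ((I.restrictScalars K).map (gradient v))
  choose f hf hfb using fun j => (b j).2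
  let W : Matrix (Fin _) σ (MvPolynomial σ K) := Matrix.of fun j i => pderiv i (f j)
  have hWv : LinearIndependent K (W.map (aeval v)).row := by
    convert! b.linearIndependent.map' _ (Submodule.ker_subtype _) using 1
    exact funext hfb
  have hW : LinearIndependent (FunctionField I) (W.map (aeval (coordinate I))).row :=
    linearIndependent_row_map (aeval v) (aeval (coordinate I))
      (fun r hr => hv r ((aeval_coordinate_eq_zero_iff I).1 hr)) hWv
  have htrdeg := trdeg_le_of_injective
    (IsScalarTower.toAlgHom K (MvPolynomial σ K ⧸ I) (FunctionField I))
    (FaithfulSMul.algebraMap_injective _ _)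
  have hcard := trdeg_add_card_le (span_range_D_coordinate I)
    (fun j => (aeval_coordinate_eq_zero_iff I).2 (hf j)) hW
  rw [Fintype.card_fin] at hcard
  exact (add_le_add_left htrdeg _).trans hcard

theorem exists_forall_eval_vecMul_eq_zero {ι κ : Type u} [Fintype ι] [Fintype κ]
    {V : Set (σ → K)} [(vanishingIdeal K V).IsPrime]
    (hV : Algebra.trdeg K (MvPolynomial σ K ⧸ vanishingIdeal K V) + Fintype.card κ <
      Fintype.card ι) (W : Matrix κ ι (MvPolynomial σ K)) :
    ∃ G : MvPolynomial ι K, G ≠ 0 ∧ ∀ v ∈ V, ∀ s : κ → K, eval (s ᵥ* W.map (eval v)) G = 0 := by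
  let A := MvPolynomial σ K ⧸ vanishingIdeal K V
  have : FaithfulSMul K A :=
    (faithfulSMul_iff_algebraMap_injective K A).2 (algebraMap K A).injective
  let z (i : ι) : MvPolynomial κ A := ∑ j, X j * C (Ideal.Quotient.mk _ (W j i))
  have hz : ¬ AlgebraicIndependent K z := fun h => by
    have hle := h.cardinalMk_le_trdeg
    rw [← trdeg_add_eq K A, MvPolynomial.trdeg_of_isDomain] at hle
    simp only [Cardinal.mk_fintype, Cardinal.lift_natCast] at hle
    exact hV.not_ge hle
  rw [algebraicIndependent_iff] at hz
  push Not at hz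
  obtain ⟨G, hG, hG0⟩ := hz
  refine ⟨G, hG0, fun v hv s => ?_⟩
  let ev : A →ₐ[K] K := Ideal.Quotient.liftₐ _ (aeval v) fun f hf => hf v hv
  have hev f : ev (Ideal.Quotient.mk _ f) = eval v f := rfl
  have hspec : ((aeval s).comp (mapAlgHom ev)) ∘ z = s ᵥ* W.map (eval v) := by
    ext i
    simp [z, hev, Matrix.vecMul, dotProduct]
  have hzero := congrArg ((aeval s).comp (mapAlgHom ev)) hG
  rw [comp_aeval_apply, map_zero] at hzero
  rw [← hspec]
  exact hzero

end Quotient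

end Transcendence

section Conical

universe u

section CommRing

variable {σ R : Type*} [CommRing R]

theorem eval_zero_derivative_restrictLine [Fintype σ] (u v : σ → R) (f : MvPolynomial σ R) :
    (Polynomial.derivative (restrictLine u v f)).eval 0 = gradient u f ⬝ᵥ v := by
  simp [derivative_restrictLine, Polynomial.eval_finsetSum, eval_restrictLine, dotProduct,
    gradient_apply]

/-- The polynomial of which `f` is the restriction to the hyperplane `v i = 1`, with all terms of
the degree of `f`. -/
noncomputable def homogenizeAt (i : σ) (f : MvPolynomial σ R) : MvPolynomial σ R :=
  ∑ j ∈ Finset.range (f.totalDegree + 1), X i ^ (f.totalDegree - j) * homogeneousComponent j f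

theorem eval_homogenizeAt (i : σ) (f : MvPolynomial σ R) (c : R) {v : σ → R} (hv : v i = 1) :
    eval (c • v) (homogenizeAt i f) = c ^ f.totalDegree * eval v f := by
  have hsum := congrArg (eval v) (sum_homogeneousComponent f)
  simp only [← hsum, homogenizeAt, map_sum, map_mul, map_pow, eval_X, Pi.smul_apply, hv,
    smul_eq_mul, mul_one, eval_smul_of_isHomogeneous (homogeneousComponent_isHomogeneous _ f),
    Finset.mul_sum]
  refine Finset.sum_congr rfl fun j hj => ?_
  rw [← mul_assoc, pow_sub_mul_pow _ (by grind)]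

end CommRing

variable {σ K : Type u} [Field K] {V : Set (σ → K)}

/-- The span at `v` of the differentials of the polynomials that vanish on `V`, written as row
vectors. -/
noncomputable def conormalSpace (V : Set (σ → K)) (v : σ → K) : Submodule K (σ → K) :=
  ((vanishingIdeal K V).restrictScalars K).map (gradient v)

theorem gradient_mem_conormalSpace {f : MvPolynomial σ K} (hf : f ∈ vanishingIdeal K V)
    (v : σ → K) : gradient v f ∈ conormalSpace V v :=
  Submodule.mem_map_of_mem hf

theorem conormalSpace_anti {U : Set (σ → K)} (h : U ⊆ V) (v : σ → K) :
    conormalSpace V v ≤ conormalSpace U v :=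
  Submodule.map_mono (vanishingIdeal_anti_mono h)

theorem dotProduct_self_of_mem_conormalSpace [Fintype σ] [Infinite K] (hV : IsConical V)
    {v h : σ → K} (hv : v ∈ V) (hh : h ∈ conormalSpace V v) : h ⬝ᵥ v = 0 := by
  obtain ⟨f, hf, rfl⟩ := hh
  have hline : (restrictLine v v f).comp (Polynomial.X - 1) = 0 :=
    polynomial_eq_zero_of_forall_ne_zero fun c hc => by
      have hcv : v + (c - 1) • v = c • v := by module
      rw [Polynomial.eval_comp]
      simpa [eval_restrictLine, hcv] using mem_vanishingIdeal_iff_eval.1 hf _ (hV v hv c hc)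
  have hzero := congrArg (fun p => p.comp (Polynomial.X + 1)) hline
  simp only [Polynomial.comp_assoc, Polynomial.sub_comp, Polynomial.X_comp, Polynomial.one_comp,
    add_sub_cancel_right, Polynomial.comp_X, Polynomial.zero_comp] at hzero
  rw [← eval_zero_derivative_restrictLine, hzero, Polynomial.derivative_zero, Polynomial.eval_zero]

/-- The section of a conical set by the affine hyperplane on which the `i`-th coordinate is one: an
affine chart of the corresponding projective set. -/
def chart (V : Set (σ → K)) (i : σ) : Set (σ → K) := V ∩ {v | v i = 1}

theorem inv_smul_mem_chart (hV : IsConical V) {i : σ} {v : σ → K} (hv : v ∈ V) (hi : v i ≠ 0) :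
    (v i)⁻¹ • v ∈ chart V i :=
  ⟨hV v hv _ (inv_ne_zero hi), inv_mul_cancel₀ hi⟩

theorem exists_mem_apply_ne_zero {i : σ} (hi : X i ∉ vanishingIdeal K V) : ∃ v ∈ V, v i ≠ 0 := by
  simpa [mem_vanishingIdeal_iff_eval] using hi

theorem mem_vanishingIdeal_of_forall_chart [hp : (vanishingIdeal K V).IsPrime] (hV : IsConical V)
    {i : σ} (hi : X i ∉ vanishingIdeal K V) {f : MvPolynomial σ K}
    (hf : ∀ v ∈ chart V i, ∀ c : K, c ≠ 0 → eval (c • v) f = 0) : f ∈ vanishingIdeal K V := by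
  refine (hp.mem_or_mem (?_ : X i * f ∈ _)).resolve_left hi
  rw [mem_vanishingIdeal_iff_eval]
  intro v hv
  rw [map_mul, eval_X]
  by_cases hvi : v i = 0
  · rw [hvi, zero_mul]
  · have h := hf _ (inv_smul_mem_chart hV hv hvi) (v i) hvi
    rw [smul_inv_smul₀ hvi] at h
    rw [h, mul_zero]

theorem mem_vanishingIdeal_chart_of_homogenizeAt {i : σ} {f : MvPolynomial σ K}
    (hf : homogenizeAt i f ∈ vanishingIdeal K V) : f ∈ vanishingIdeal K (chart V i) := by
  rw [mem_vanishingIdeal_iff_eval] at hf ⊢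
  rintro v ⟨hv, hvi⟩
  simpa [hf v hv] using (eval_homogenizeAt i f 1 hvi).symm

theorem isPrime_vanishingIdeal_chart [hp : (vanishingIdeal K V).IsPrime] (hV : IsConical V) {i : σ}
    (hi : X i ∉ vanishingIdeal K V) : (vanishingIdeal K (chart V i)).IsPrime where
  ne_top' := by
    obtain ⟨v, hv, hvi⟩ := exists_mem_apply_ne_zero hi
    rw [Ideal.ne_top_iff_one, mem_vanishingIdeal_iff_eval]
    exact fun h => one_ne_zero (α := K) (by simpa using h _ (inv_smul_mem_chart hV hv hvi))
  mem_or_mem' := by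
    intro f g hfg
    rw [mem_vanishingIdeal_iff_eval] at hfg
    have hmul : homogenizeAt i f * homogenizeAt i g ∈ vanishingIdeal K V :=
      mem_vanishingIdeal_of_forall_chart hV hi fun v hv c _ => by
        rw [map_mul, eval_homogenizeAt _ _ _ hv.2, eval_homogenizeAt _ _ _ hv.2, mul_mul_mul_comm,
          ← map_mul, hfg v hv, mul_zero]
    exact (hp.mem_or_mem hmul).imp mem_vanishingIdeal_chart_of_homogenizeAt
      mem_vanishingIdeal_chart_of_homogenizeAt

/-- The differential of `v i` is not conormal to `V` at a point of the chart, by Euler's relation,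
so the conormal space of the chart is strictly larger than that of `V`. -/
theorem trdeg_chart_add_finrank_conormalSpace_le [Fintype σ] [CharZero K]
    [(vanishingIdeal K V).IsPrime] (hV : IsConical V) {i : σ} {v : σ → K} (hv : v ∈ chart V i) :
    Algebra.trdeg K (MvPolynomial σ K ⧸ vanishingIdeal K (chart V i)) +
      (Module.finrank K (conormalSpace V v) + 1 : ℕ) ≤ Fintype.card σ := by
  classical
  have hi : X i ∉ vanishingIdeal K V := fun h => by
    simpa [hv.2.out] using mem_vanishingIdeal_iff_eval.1 h v hv.1
  have := isPrime_vanishingIdeal_chart hV hi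
  have hX : gradient v (X i - 1) ∈ conormalSpace (chart V i) v :=
    gradient_mem_conormalSpace (mem_vanishingIdeal_iff_eval.2 fun u hu => by simp [hu.2.out]) v
  have hdot : gradient v (X i - 1) ⬝ᵥ v = 1 := by
    have hsingle : gradient v (X i - 1) = Pi.single i 1 := by
      ext j
      rw [gradient_apply, map_sub, pderiv_one, sub_zero, pderiv_X, Pi.single_comm]
      simp [Pi.single_apply, apply_ite]
    rw [hsingle, single_one_dotProduct]
    exact hv.2
  have hlt : conormalSpace V v < conormalSpace (chart V i) v :=
    SetLike.lt_iff_le_and_exists.2 ⟨conormalSpace_anti Set.inter_subset_left v, _, hX, fun h =>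
      one_ne_zero (α := K) <| by
      rw [← hdot]
      exact dotProduct_self_of_mem_conormalSpace hV hv.1 h⟩
  refine (add_le_add_right (Nat.cast_le.2 (Submodule.finrank_lt_finrank_of_lt hlt)) _).trans ?_
  exact trdeg_add_finrank_gradient_le fun f hf => mem_vanishingIdeal_iff_eval.1 hf v hv

end Conical

section Orthogonal

variable {ι κ K : Type*} [Fintype ι] [Field K]

/-- The orthogonal complement for the dot product: the annihilator of a space of row vectors. -/
noncomputable def dotOrthogonal (E : Submodule K (ι → K)) : Submodule K (ι → K) :=
  LinearMap.BilinForm.orthogonal (dotProductBilin K K) E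

theorem mem_dotOrthogonal {E : Submodule K (ι → K)} {w : ι → K} :
    w ∈ dotOrthogonal E ↔ ∀ h ∈ E, h ⬝ᵥ w = 0 :=
  LinearMap.BilinForm.mem_orthogonal_iff

theorem dotProductBilin_isRefl :
    LinearMap.BilinForm.IsRefl (dotProductBilin K K : LinearMap.BilinForm K (ι → K)) :=
  fun x y h => (dotProduct_comm y x).trans h

theorem dotProductBilin_nondegenerate :
    LinearMap.BilinForm.Nondegenerate (dotProductBilin K K : LinearMap.BilinForm K (ι → K)) :=
  ⟨fun x h => dotProduct_eq_zero x fun w => h w,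
    fun x h => dotProduct_eq_zero x fun w => (dotProduct_comm x w).trans (h w)⟩

theorem dotOrthogonal_dotOrthogonal (E : Submodule K (ι → K)) :
    dotOrthogonal (dotOrthogonal E) = E :=
  LinearMap.BilinForm.orthogonal_orthogonal dotProductBilin_nondegenerate dotProductBilin_isRefl E

theorem finrank_dotOrthogonal (E : Submodule K (ι → K)) :
    Module.finrank K (dotOrthogonal E) = Fintype.card ι - Module.finrank K E := by
  rw [dotOrthogonal, LinearMap.BilinForm.finrank_orthogonal dotProductBilin_nondegenerate,
    Module.finrank_pi]

theorem exists_eq_vecMul_of_det_ne_zero [Fintype κ] [DecidableEq κ] {E : Submodule K (ι → K)}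
    (hE : Module.finrank K E = Fintype.card κ) {A : Matrix κ ι K} (hA : ∀ j, A j ∈ E)
    {L : Matrix ι κ K} (hL : (A * L).det ≠ 0) {w : ι → K} (hw : w ∈ E) : ∃ s, w = s ᵥ* A := by
  have hli : LinearIndependent K A.row := by
    rw [← Matrix.vecMul_injective_iff]
    intro s t hst
    exact Matrix.vecMul_injective_of_isUnit ((Matrix.isUnit_iff_isUnit_det _).2 hL.isUnit)
      (by simpa only [Matrix.vecMul_vecMul] using congrArg (· ᵥ* L) hst)
  have hspan : Submodule.span K (Set.range A.row) = E :=
    Submodule.eq_of_le_of_finrank_eq (Submodule.span_le.2 (Set.range_subset_iff.2 hA))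
      (by rw [finrank_span_eq_card hli, hE])
  rw [← hspan, Submodule.mem_span_range_iff_exists_fun] at hw
  obtain ⟨s, hs⟩ := hw
  exact ⟨s, by rw [Matrix.vecMul_eq_sum, ← hs]; rfl⟩

end Orthogonal

section GloballyGenerated

universe u

variable {σ ι K : Type u} [Field K] {V : Set (σ → K)} {E : (σ → K) → Submodule K (ι → K)}

/-- A family of linear subspaces over `V` is globally generated if each of its vectors is the value
of a polynomial vector field whose values over `V` all belong to the family. -/
def GloballyGenerated (V : Set (σ → K)) (E : (σ → K) → Submodule K (ι → K)) : Prop :=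
  ∀ v ∈ V, ∀ w ∈ E v, ∃ W : ι → MvPolynomial σ K,
    (∀ u ∈ V, evalField u W ∈ E u) ∧ evalField v W = w

/-- The union of the members of a family of linear subspaces over `V`. -/
def totalSpace (V : Set (σ → K)) (E : (σ → K) → Submodule K (ι → K)) : Set (ι → K) :=
  {w | ∃ v ∈ V, w ∈ E v}

theorem globallyGenerated_conormalSpace : GloballyGenerated V (conormalSpace V) := by
  rintro v - _ ⟨f, hf, rfl⟩
  exact ⟨fun i => pderiv i f, fun u _ => gradient_mem_conormalSpace hf u, rfl⟩

/-- The union of the conormal spaces. For the affine cone over a smooth projective variety it is the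
affine cone, vertex included, over the dual variety. -/
abbrev dualCone (V : Set (σ → K)) : Set (σ → K) := totalSpace V (conormalSpace V)

theorem isConical_totalSpace : IsConical (totalSpace V E) :=
  fun _ ⟨v, hv, hw⟩ c _ => ⟨v, hv, Submodule.smul_mem _ c hw⟩

theorem mem_vanishingIdeal_of_forall_eval_ne_zero [hp : (vanishingIdeal K V).IsPrime]
    {f g : MvPolynomial σ K} (hg : g ∉ vanishingIdeal K V)
    (h : ∀ v ∈ V, eval v g ≠ 0 → eval v f = 0) : f ∈ vanishingIdeal K V := by
  refine (hp.mem_or_mem (y := g) ?_).resolve_right hg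
  rw [mem_vanishingIdeal_iff_eval]
  intro v hv
  rw [map_mul, mul_eq_zero, or_iff_not_imp_right]
  exact h v hv

theorem GloballyGenerated.exists_frame [Fintype ι] (hE : GloballyGenerated V E) {v : σ → K}
    (hv : v ∈ V) :
    ∃ (W : Matrix (Fin (Module.finrank K (E v))) ι (MvPolynomial σ K))
      (L : Matrix ι (Fin (Module.finrank K (E v))) K),
      (∀ u ∈ V, ∀ j, W.map (eval u) j ∈ E u) ∧ W.map (eval v) * L = 1 := by
  let b := Module.finBasis K (E v)
  choose W hWE hWb using fun j => hE v hv (b j) (b j).2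
  have hli : LinearIndependent K (Matrix.map (Matrix.of W) (eval v)).row := by
    convert! b.linearIndependent.map' _ (Submodule.ker_subtype _) using 1
    exact funext hWb
  obtain ⟨L, hL⟩ := exists_mul_eq_one_of_linearIndependent hli
  exact ⟨Matrix.of W, L, fun u hu j => hWE j u hu, hL⟩

theorem isPrime_vanishingIdeal_totalSpace [Infinite K] [hp : (vanishingIdeal K V).IsPrime]
    (hne : V.Nonempty) (hE : GloballyGenerated V E) :
    (vanishingIdeal K (totalSpace V E)).IsPrime where
  ne_top' := by
    obtain ⟨v, hv⟩ := hne
    rw [Ideal.ne_top_iff_one, mem_vanishingIdeal_iff_eval]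
    exact fun h => one_ne_zero (α := K) (by simpa using h 0 ⟨v, hv, zero_mem _⟩)
  mem_or_mem' := by
    intro f g hfg
    by_contra! hcon
    simp only [mem_vanishingIdeal_iff_eval] at hfg hcon
    push Not at hcon
    obtain ⟨⟨_, ⟨v₁, hv₁, hw₁⟩, hf⟩, _, ⟨v₂, hv₂, hw₂⟩, hg⟩ := hcon
    obtain ⟨W₁, hW₁, rfl⟩ := hE v₁ hv₁ _ hw₁
    obtain ⟨W₂, hW₂, rfl⟩ := hE v₂ hv₂ _ hw₂
    rw [eval_evalField] at hf hg
    obtain ⟨v, hv, hfv, hgv⟩ : ∃ v ∈ V, eval (evalField v W₁) f ≠ 0 ∧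
        eval (evalField v W₂) g ≠ 0 := by
      have hmul := hp.mul_notMem (x := aeval W₁ f) (y := aeval W₂ g)
        (fun h => hf (mem_vanishingIdeal_iff_eval.1 h v₁ hv₁))
        (fun h => hg (mem_vanishingIdeal_iff_eval.1 h v₂ hv₂))
      simpa [mem_vanishingIdeal_iff_eval, eval_evalField] using hmul
    -- Both `f` and `g` are non-zero on the line that joins the values of the two fields at `v`.
    let line := restrictLine (R := K) (evalField v W₁) (evalField v W₂ - evalField v W₁)
    have hline : line f * line g = 0 := Polynomial.funext fun s => by
      rw [← map_mul, eval_restrictLine, Polynomial.eval_zero]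
      exact hfg _ ⟨v, hv, add_mem (hW₁ v hv)
        (Submodule.smul_mem _ s (sub_mem (hW₂ v hv) (hW₁ v hv)))⟩
    rcases mul_eq_zero.1 hline with h | h
    · have h0 := congrArg (Polynomial.eval 0) h
      rw [eval_restrictLine, zero_smul, add_zero, Polynomial.eval_zero] at h0
      exact hfv h0
    · have h1 := congrArg (Polynomial.eval 1) h
      rw [eval_restrictLine, one_smul, add_sub_cancel, Polynomial.eval_zero] at h1
      exact hgv h1

theorem evalField_mulVec {κ τ : Type*} [Fintype τ] (u : σ → K)
    (M : Matrix κ τ (MvPolynomial σ K)) (W : τ → MvPolynomial σ K) :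
    evalField u (M *ᵥ W) = M.map (eval u) *ᵥ evalField u W :=
  funext fun i => RingHom.map_mulVec (eval u) M W i

theorem map_eval_mul_map_C {κ τ : Type*} [Fintype τ] (W : Matrix κ τ (MvPolynomial σ K))
    (L : Matrix τ κ K) (u : σ → K) :
    (W * L.map (C (σ := σ))).map (eval u) = W.map (eval u) * L := by
  ext
  simp [Matrix.mul_apply]

theorem eval_det_mul_map_C {κ τ : Type*} [Fintype τ] [Fintype κ] [DecidableEq κ]
    (W : Matrix κ τ (MvPolynomial σ K)) (L : Matrix τ κ K) (u : σ → K) :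
    eval u (W * L.map (C (σ := σ))).det = (W.map (eval u) * L).det := by
  rw [RingHom.map_det, ← map_eval_mul_map_C]
  rfl

theorem mem_vanishingIdeal_of_frame {κ : Type*} [Fintype ι] [Fintype κ] [DecidableEq κ]
    [(vanishingIdeal K V).IsPrime] {v : σ → K} (hv : v ∈ V)
    {W : Matrix κ ι (MvPolynomial σ K)} {L : Matrix ι κ K}
    (hWE : ∀ u ∈ V, ∀ j, W.map (eval u) j ∈ E u) (hWL : W.map (eval v) * L = 1)
    (hk : ∀ u ∈ V, Module.finrank K (E u) = Fintype.card κ) {S : ι → MvPolynomial σ K}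
    (hS : ∀ u ∈ V, evalField u S ∈ E u) {f : MvPolynomial σ K}
    (hf : ∀ u ∈ V, ∀ s, evalField u S = s ᵥ* W.map (eval u) → eval u f = 0) :
    f ∈ vanishingIdeal K V := by
  refine mem_vanishingIdeal_of_forall_eval_ne_zero (g := (W * L.map (C (σ := σ))).det)
    (fun hmem => ?_) fun u hu hdet => ?_
  · have hone := mem_vanishingIdeal_iff_eval.1 hmem v hv
    rw [eval_det_mul_map_C, hWL, Matrix.det_one] at hone
    exact one_ne_zero hone
  · rw [eval_det_mul_map_C] at hdet
    obtain ⟨s, hs⟩ := exists_eq_vecMul_of_det_ne_zero (hk u hu) (hWE u hu) hdet (hS u hu)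
    exact hf u hu s hs

/-- Polynomial form of the map `w ↦ det (W L) w - L adj (W L) W w`, whose values are annihilated by
the rows of `W`. -/
noncomputable def annihilatedField {κ : Type*} [Fintype ι] [Fintype κ] [DecidableEq κ]
    (W : Matrix κ ι (MvPolynomial σ K)) (L : Matrix ι κ K) (w : ι → K) : ι → MvPolynomial σ K :=
  (W * L.map (C (σ := σ))).det • (C ∘ w) -
    (L.map (C (σ := σ)) * (W * L.map (C (σ := σ))).adjugate * W) *ᵥ (C ∘ w)

theorem evalField_annihilatedField {κ : Type*} [Fintype ι] [Fintype κ] [DecidableEq κ]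
    (W : Matrix κ ι (MvPolynomial σ K)) (L : Matrix ι κ K) (w : ι → K) (u : σ → K) :
    evalField u (annihilatedField W L w) = (W.map (eval u) * L).det • w -
      (L * (W.map (eval u) * L).adjugate * W.map (eval u)) *ᵥ w := by
  have hL : (L.map (C (σ := σ))).map (eval u) = L := by ext; simp
  have hw : evalField u (C ∘ w) = w := by ext; simp [evalField]
  have hadj : (W * L.map (C (σ := σ))).adjugate.map (eval u) = (W.map (eval u) * L).adjugate := by
    rw [← map_eval_mul_map_C]
    exact RingHom.map_adjugate (eval u) _
  have hsub : evalField u (annihilatedField W L w) =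
      eval u (W * L.map (C (σ := σ))).det • evalField u (C ∘ w) -
        evalField u ((L.map (C (σ := σ)) * (W * L.map (C (σ := σ))).adjugate * W) *ᵥ (C ∘ w)) := by
    ext
    simp [annihilatedField, evalField]
  rw [hsub, evalField_mulVec, Matrix.map_mul, Matrix.map_mul, hadj, hL, hw, eval_det_mul_map_C]

theorem mulVec_evalField_annihilatedField {κ : Type*} [Fintype ι] [Fintype κ] [DecidableEq κ]
    (W : Matrix κ ι (MvPolynomial σ K)) (L : Matrix ι κ K) (w : ι → K) (u : σ → K) :
    W.map (eval u) *ᵥ evalField u (annihilatedField W L w) = 0 := by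
  rw [evalField_annihilatedField, Matrix.mulVec_sub, Matrix.mulVec_mulVec, ← Matrix.mul_assoc,
    ← Matrix.mul_assoc, Matrix.mul_adjugate, Matrix.mulVec_smul, Matrix.smul_mul, Matrix.one_mul,
    Matrix.smul_mulVec, sub_self]

theorem GloballyGenerated.dotOrthogonal [Fintype ι] [(vanishingIdeal K V).IsPrime] {k : ℕ}
    (hE : GloballyGenerated V E) (hk : ∀ v ∈ V, Module.finrank K (E v) = k) :
    GloballyGenerated V fun v => dotOrthogonal (E v) := by
  intro v hv w hw
  obtain ⟨W, L, hWE, hWL⟩ := hE.exists_frame hv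
  let F := annihilatedField W L w
  refine ⟨F, fun u hu => mem_dotOrthogonal.2 fun h hh => ?_, ?_⟩
  · obtain ⟨S, hS, rfl⟩ := hE u hu h hh
    have hmem : ∑ i, S i * F i ∈ vanishingIdeal K V :=
      mem_vanishingIdeal_of_frame hv hWE hWL
        (fun u hu => by rw [hk u hu, hk v hv, Fintype.card_fin])
        hS fun u _ s hs => by
          simp only [map_sum, map_mul]
          change evalField u S ⬝ᵥ evalField u F = 0
          rw [hs, ← Matrix.dotProduct_mulVec, mulVec_evalField_annihilatedField, dotProduct_zero]
    simpa [dotProduct, evalField] using mem_vanishingIdeal_iff_eval.1 hmem u hu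
  · have hWw : W.map (eval v) *ᵥ w = 0 := funext fun j => mem_dotOrthogonal.1 hw _ (hWE v hv j)
    rw [evalField_annihilatedField, ← Matrix.mulVec_mulVec, hWw, hWL, Matrix.det_one, one_smul,
      Matrix.mulVec_zero, sub_zero]

/-- Over the chart the family is parametrized, outside the vanishing locus of the determinant of a
frame, by `trdeg + k` functions; global generation extends the resulting equation to the whole
family. -/
theorem GloballyGenerated.exists_equation [Fintype ι] [(vanishingIdeal K V).IsPrime]
    (hE : GloballyGenerated V E) (hV : IsConical V) {i : σ} (hi : X i ∉ vanishingIdeal K V)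
    (hsmul : ∀ c : K, c ≠ 0 → ∀ v, E (c • v) = E v) {k : ℕ}
    (hk : ∀ v ∈ V, Module.finrank K (E v) = k)
    (hdim : Algebra.trdeg K (MvPolynomial σ K ⧸ vanishingIdeal K (chart V i)) + k <
      Fintype.card ι) :
    ∃ G : MvPolynomial ι K, G ≠ 0 ∧ G ∈ vanishingIdeal K (totalSpace V E) := by
  have := isPrime_vanishingIdeal_chart hV hi
  obtain ⟨v₀, hv₀, hvi₀⟩ := exists_mem_apply_ne_zero hi
  have hv₁ := inv_smul_mem_chart hV hv₀ hvi₀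
  obtain ⟨W, L, hWE, hWL⟩ := hE.exists_frame hv₁.1
  obtain ⟨G, hG0, hG⟩ := exists_forall_eval_vecMul_eq_zero (V := chart V i)
    (by simpa [hk _ hv₁.1] using hdim) (W.submatrix ULift.down.{u} id)
  refine ⟨G, hG0, mem_vanishingIdeal_iff_eval.2 ?_⟩
  have hchart {S : ι → MvPolynomial σ K} (hS : ∀ u ∈ V, evalField u S ∈ E u) :
      aeval S G ∈ vanishingIdeal K (chart V i) :=
    mem_vanishingIdeal_of_frame hv₁ (fun u hu => hWE u hu.1) hWL
      (fun u hu => by rw [hk u hu.1, hk _ hv₁.1, Fintype.card_fin]) (fun u hu => hS u hu.1)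
      fun u hu s hs => by
        rw [← eval_evalField, hs, ← hG u hu (s ∘ ULift.down)]
        congr 2
        ext j
        simp only [Matrix.vecMul, dotProduct]
        exact (Equiv.ulift.sum_comp fun x => s x * _).symm
  rintro w ⟨v, hv, hw⟩
  obtain ⟨S, hS, rfl⟩ := hE v hv w hw
  have hmem : aeval S G ∈ vanishingIdeal K V :=
    mem_vanishingIdeal_of_forall_eval_ne_zero hi fun u hu hui => by
      rw [eval_X] at hui
      have hu₁ := inv_smul_mem_chart hV hu hui
      obtain ⟨T, hT, hTu⟩ := hE _ hu₁.1 (evalField u S) <| by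
        rw [hsmul _ (inv_ne_zero hui)]
        exact hS u hu
      rw [← eval_evalField, ← hTu, eval_evalField]
      exact mem_vanishingIdeal_iff_eval.1 (hchart hT) _ hu₁
  rw [eval_evalField]
  exact mem_vanishingIdeal_iff_eval.1 hmem v hv

end GloballyGenerated

section AffineTangentSpace

universe u

section Fintype

variable {σ τ K : Type u} [Fintype σ] [Fintype τ] [Field K] {V : Set (σ → K)}

/-- The common kernel of the differentials at `v` of the polynomials that vanish on `V`. For a cone
`V` over a projective set this is the linear subspace of the embedded projective tangent space. -/
noncomputable def affineTangentSpace (V : Set (σ → K)) (v : σ → K) : Submodule K (σ → K) :=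
  dotOrthogonal (conormalSpace V v)

theorem mem_affineTangentSpace {v w : σ → K} :
    w ∈ affineTangentSpace V v ↔ ∀ f ∈ vanishingIdeal K V, gradient v f ⬝ᵥ w = 0 := by
  rw [affineTangentSpace, mem_dotOrthogonal]
  exact Set.forall_mem_image

theorem mem_conormalSpace_iff {v h : σ → K} :
    h ∈ conormalSpace V v ↔ ∀ w ∈ affineTangentSpace V v, h ⬝ᵥ w = 0 := by
  rw [← dotOrthogonal_dotOrthogonal (conormalSpace V v), mem_dotOrthogonal]
  exact forall₂_congr fun w _ => by rw [dotProduct_comm]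

theorem finrank_conormalSpace (v : σ → K) : Module.finrank K (conormalSpace V v) =
    Fintype.card σ - Module.finrank K (affineTangentSpace V v) := by
  rw [← finrank_dotOrthogonal, affineTangentSpace, dotOrthogonal_dotOrthogonal]

theorem self_mem_affineTangentSpace [Infinite K] (hV : IsConical V) {v : σ → K} (hv : v ∈ V) :
    v ∈ affineTangentSpace V v :=
  mem_dotOrthogonal.2 fun _ => dotProduct_self_of_mem_conormalSpace hV hv

theorem mulVec_mem_affineTangentSpace {V' : Set (τ → K)} {M : Matrix τ σ K}
    (hM : ∀ v ∈ V, M *ᵥ v ∈ V') {v w : σ → K} (hw : w ∈ affineTangentSpace V v) :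
    M *ᵥ w ∈ affineTangentSpace V' (M *ᵥ v) := by
  rw [mem_affineTangentSpace] at hw ⊢
  intro f hf
  rw [Matrix.dotProduct_mulVec, ← gradient_compMulVec]
  refine hw _ (mem_vanishingIdeal_iff_eval.2 fun u hu => ?_)
  rw [eval_compMulVec]
  exact mem_vanishingIdeal_iff_eval.1 hf _ (hM u hu)

theorem affineTangentSpace_le_smul (hV : IsConical V) {c : K} (hc : c ≠ 0) (v : σ → K) :
    affineTangentSpace V v ≤ affineTangentSpace V (c • v) := by
  classical
  intro w hw
  have h := mulVec_mem_affineTangentSpace (M := c • (1 : Matrix σ σ K)) (V' := V)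
    (fun u hu => by simpa [Matrix.smul_mulVec] using hV u hu c hc) hw
  simp only [Matrix.smul_mulVec, Matrix.one_mulVec] at h
  exact (Submodule.smul_mem_iff _ hc).1 h

theorem affineTangentSpace_smul (hV : IsConical V) (c : K) (hc : c ≠ 0) (v : σ → K) :
    affineTangentSpace V (c • v) = affineTangentSpace V v :=
  le_antisymm (by simpa [hc] using affineTangentSpace_le_smul hV (inv_ne_zero hc) (c • v))
    (affineTangentSpace_le_smul hV hc v)

theorem exists_forall_mem_affineTangentSpace_of_finite [hp : (vanishingIdeal K V).IsPrime]
    {g : MvPolynomial σ K} (hg : g ∉ vanishingIdeal K V) {S : Set (σ → K)} (hS : S.Finite)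
    (h : ∀ v ∈ V, eval v g ≠ 0 → ∃ q ∈ S, q ∈ affineTangentSpace V v) :
    ∃ q ∈ S, ∀ v ∈ V, q ∈ affineTangentSpace V v := by
  classical
  by_contra! hcon
  have hsep : ∀ q ∈ S, ∃ f ∈ vanishingIdeal K V,
      ∑ i, pderiv i f * C (q i) ∉ vanishingIdeal K V := by
    intro q hqS
    obtain ⟨v, hv, hqv⟩ := hcon q hqS
    simp only [mem_affineTangentSpace, not_forall] at hqv
    obtain ⟨f, hf, hne⟩ := hqv
    refine ⟨f, hf, fun hmem => hne ?_⟩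
    simpa [dotProduct, gradient_apply] using mem_vanishingIdeal_iff_eval.1 hmem v hv
  choose! f hf hfn using hsep
  have hprod : ∏ q ∈ hS.toFinset, ∑ i, pderiv i (f q) * C (q i) ∈ vanishingIdeal K V := by
    refine mem_vanishingIdeal_of_forall_eval_ne_zero hg fun v hv hgv => ?_
    obtain ⟨q, hqS, hqv⟩ := h v hv hgv
    rw [map_prod]
    refine Finset.prod_eq_zero (hS.mem_toFinset.2 hqS) ?_
    simpa [dotProduct, gradient_apply] using mem_affineTangentSpace.1 hqv _ (hf q hqS)
  obtain ⟨q, hq, hmem⟩ := hp.prod_mem_iff.1 hprod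
  exact hfn q (hS.mem_toFinset.1 hq) hmem

end Fintype

theorem conormalSpace_smul {σ K : Type u} [Finite σ] [Field K] {V : Set (σ → K)}
    (hV : IsConical V) (c : K) (hc : c ≠ 0) (v : σ → K) :
    conormalSpace V (c • v) = conormalSpace V v := by
  cases nonempty_fintype σ
  ext h
  rw [mem_conormalSpace_iff, mem_conormalSpace_iff, affineTangentSpace_smul hV c hc]

end AffineTangentSpace

section Hyperplanes

variable {σ K : Type*} [Fintype σ] [Field K]

/-- The linear form with coefficient vector `q`. -/
noncomputable def linearForm (q : σ → K) : MvPolynomial σ K :=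
  sumSMulX (Finsupp.equivFunOnFinite.symm q)

theorem coeff_linearForm (q : σ → K) (i : σ) :
    (linearForm q).coeff (Finsupp.single i 1) = q i := by
  simp [linearForm, coeff_sumSMulX]

theorem eval_linearForm (q x : σ → K) : eval x (linearForm q) = q ⬝ᵥ x := by
  simp [linearForm, sumSMulX, Finsupp.linearCombination_apply, dotProduct, Finsupp.sum_fintype,
    smul_eval]

theorem prime_linearForm {q : σ → K} (hq : q ≠ 0) : Prime (linearForm q) := by
  obtain ⟨i, hi⟩ := Function.ne_iff.1 hq
  refine (irreducible_sumSMulX _ ⟨i, by simpa using hi⟩ fun r hr => ?_).prime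
  rw [isUnit_iff_ne_zero]
  rintro rfl
  exact hi (by simpa using hr i)

theorem linearForm_dvd [IsAlgClosed K] {q : σ → K} (hq : q ≠ 0) {f : MvPolynomial σ K}
    (h : ∀ x, q ⬝ᵥ x = 0 → eval x f = 0) : linearForm q ∣ f := by
  have hprime : (Ideal.span {linearForm q}).IsPrime :=
    (Ideal.span_singleton_prime (prime_linearForm hq).ne_zero).2 (prime_linearForm hq)
  rw [← Ideal.mem_span_singleton, ← hprime.radical,
    ← vanishingIdeal_zeroLocus_eq_radical (K := K), mem_vanishingIdeal_iff_eval]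
  refine fun x hx => h x ?_
  rw [← eval_linearForm, ← aeval_eq_eval]
  exact hx _ (Ideal.mem_span_singleton_self _)

theorem finite_setOf_forall_dotProduct_eq_zero [IsAlgClosed K] {f : MvPolynomial σ K}
    (hf : f ≠ 0) : {P : ℙ K (σ → K) | ∀ x, P.rep ⬝ᵥ x = 0 → eval x f = 0}.Finite := by
  classical
  let := UniqueFactorizationMonoid.fintypeSubtypeDvd (Associates.mk f) (Associates.mk_ne_zero.2 hf)
  have hfin : {a | a ∣ Associates.mk f}.Finite :=
    Set.finite_coe_iff.1 (Finite.of_fintype {a // a ∣ Associates.mk f})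
  refine hfin.of_injOn (f := fun P => Associates.mk (linearForm P.rep))
    (fun P hP => Associates.mk_dvd_mk.2 (linearForm_dvd P.rep_nonzero hP)) ?_
  intro P _ Q _ hPQ
  obtain ⟨u, hu⟩ := (Associates.mk_eq_mk_iff_associated.1 hPQ).symm
  obtain ⟨c, -, hcu⟩ := MvPolynomial.isUnit_iff_eq_C_of_isReduced.1 u.isUnit
  rw [← P.mk_rep, ← Q.mk_rep, Projectivization.mk_eq_mk_iff']
  refine ⟨c, funext fun i => ?_⟩
  rw [← coeff_linearForm P.rep, ← hu, hcu, mul_comm, coeff_C_mul, coeff_linearForm]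
  rfl

end Hyperplanes

section Pairs

variable {σ K : Type*} [Field K]

theorem linearIndependent_pair_of_apply_eq_zero {v w : σ → K} {i : σ} (hv : v i ≠ 0)
    (hwi : w i = 0) (hw : w ≠ 0) : LinearIndependent K ![v, w] := by
  rw [LinearIndependent.pair_iff]
  intro s t hst
  have hs : s = 0 := by simpa [hv, hwi] using congrFun hst i
  exact ⟨hs, by simpa [hs, hw] using hst⟩

theorem span_pair_eq_of_finrank_eq_two {E : Submodule K (σ → K)} (hE : Module.finrank K E = 2)
    {v w : σ → K} (hv : v ∈ E) (hw : w ∈ E) (hvw : LinearIndependent K ![v, w]) :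
    Submodule.span K {v, w} = E := by
  have := Module.finite_of_finrank_eq_succ hE
  refine Submodule.eq_of_le_of_finrank_eq (Submodule.span_le.2 (Set.pair_subset hv hw)) ?_
  rw [hE, ← Matrix.range_cons_cons_empty, finrank_span_eq_card hvw, Fintype.card_fin]

theorem exists_mem_ne_zero_dotProduct_eq_zero [Fintype σ] {E : Submodule K (σ → K)}
    (hE : 1 < Module.finrank K E) (o : σ → K) : ∃ w ∈ E, w ≠ 0 ∧ w ⬝ᵥ o = 0 := by
  have hker := LinearMap.ker_ne_bot_of_finrank_lt
    (f := (dotProductBilin K K).flip o ∘ₗ E.subtype) (by rwa [Module.finrank_self])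
  obtain ⟨w, hw, hw0⟩ := Submodule.exists_mem_ne_zero_of_ne_bot hker
  exact ⟨w, w.2, by simpa using hw0, hw⟩

end Pairs

section DominantProjection

universe u

variable {σ K : Type u} [Fintype σ] [DecidableEq σ] [Field K] [IsAlgClosed K] {V : Set (σ → K)}

/-- If `w` spans `affineTangentSpace V v` together with `v`, every hyperplane through `w` becomes
one that contains this space after a change of its `i`-th coordinate. -/
theorem eval_eq_zero_of_dotProduct_eq_zero (hV : IsConical V) {v w : σ → K} (hv : v ∈ V)
    (hT : Module.finrank K (affineTangentSpace V v) = 2) {i : σ} (hvi : v i ≠ 0)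
    (hwT : w ∈ affineTangentSpace V v) (hwi : w i = 0) (hw : w ≠ 0) {F : MvPolynomial σ K}
    (hFi : ∀ (x : σ → K) (t : K), eval (x + t • Pi.single i 1) F = eval x F)
    (hF : F ∈ vanishingIdeal K (dualCone V)) {x : σ → K} (hx : w ⬝ᵥ x = 0) :
    eval x F = 0 := by
  rw [← hFi x (-(x ⬝ᵥ v) / v i)]
  refine mem_vanishingIdeal_iff_eval.1 hF _ ⟨v, hv, mem_conormalSpace_iff.2 fun u hu => ?_⟩
  rw [← span_pair_eq_of_finrank_eq_two hT (self_mem_affineTangentSpace hV hv) hwT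
    (linearIndependent_pair_of_apply_eq_zero hvi hwi hw), Submodule.mem_span_pair] at hu
  obtain ⟨a, b, rfl⟩ := hu
  simp [add_dotProduct, dotProduct_add, hwi, dotProduct_comm x w, hx, div_mul_cancel₀ _ hvi]

theorem exists_forall_mem_affineTangentSpace [(vanishingIdeal K V).IsPrime] (hV : IsConical V)
    (hT : ∀ v ∈ V, Module.finrank K (affineTangentSpace V v) = 2) {i : σ}
    (hi : X i ∉ vanishingIdeal K V) {F : MvPolynomial σ K} (hF0 : F ≠ 0)
    (hFi : ∀ (x : σ → K) (t : K), eval (x + t • Pi.single i 1) F = eval x F)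
    (hF : F ∈ vanishingIdeal K (dualCone V)) :
    ∃ q : σ → K, q ≠ 0 ∧ q i = 0 ∧ ∀ v ∈ V, q ∈ affineTangentSpace V v := by
  let S : Set (ℙ K (σ → K)) := {P | P.rep i = 0 ∧ ∀ x, P.rep ⬝ᵥ x = 0 → eval x F = 0}
  have hS : S.Finite := (finite_setOf_forall_dotProduct_eq_zero hF0).subset fun P hP => hP.2
  obtain ⟨_, ⟨P, hP, rfl⟩, hPT⟩ := exists_forall_mem_affineTangentSpace_of_finite hi
    (hS.image Projectivization.rep) fun v hv hvi => by
      rw [eval_X] at hvi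
      obtain ⟨w, hwT, hw, hwi⟩ :=
        exists_mem_ne_zero_dotProduct_eq_zero
          (E := affineTangentSpace V v) (by rw [hT v hv]; simp) (Pi.single i 1)
      rw [dotProduct_single_one] at hwi
      obtain ⟨a, ha⟩ := Projectivization.exists_smul_eq_mk_rep K w hw
      have haT : (Projectivization.mk K w hw).rep ∈ affineTangentSpace V v :=
        ha ▸ Submodule.smul_mem _ _ hwT
      have hai : (Projectivization.mk K w hw).rep i = 0 := by
        rw [← ha, Pi.smul_apply, hwi, smul_zero]
      exact ⟨_, ⟨_, ⟨hai, fun x => eval_eq_zero_of_dotProduct_eq_zero hV hv (hT v hv) hvi haT hai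
        (Projectivization.rep_nonzero _) hFi hF⟩, rfl⟩, haT⟩
  exact ⟨P.rep, P.rep_nonzero, hP.1, hPT⟩

/-- Two common tangent vectors would span all the tangent spaces, so that these would be equal and
`V` would be contained in them. -/
theorem exists_forall_eq_zero_of_mem_vanishingIdeal_conormal [(vanishingIdeal K V).IsPrime]
    (hV : IsConical V) (hT : ∀ v ∈ V, Module.finrank K (affineTangentSpace V v) = 2)
    (hcard : 2 < Fintype.card σ) (hplane : ∀ h : σ → K, h ≠ 0 → ∃ v ∈ V, h ⬝ᵥ v ≠ 0) :
    ∃ i : σ, ∀ F ∈ vanishingIdeal K (dualCone V),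
      (∀ (x : σ → K) (t : K), eval (x + t • Pi.single i 1) F = eval x F) → F = 0 := by
  by_contra! hcon
  have hcommon (i : σ) : ∃ q : σ → K, q ≠ 0 ∧ q i = 0 ∧ ∀ v ∈ V, q ∈ affineTangentSpace V v := by
    obtain ⟨F, hF, hFi, hF0⟩ := hcon i
    refine exists_forall_mem_affineTangentSpace hV hT (fun hi => ?_) hF0 hFi hF
    obtain ⟨v, hv, hne⟩ := hplane (Pi.single i 1) (by simp)
    exact hne (by simpa using mem_vanishingIdeal_iff_eval.1 hi v hv)
  obtain ⟨i⟩ : Nonempty σ := Fintype.card_pos_iff.1 (by omega)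
  obtain ⟨q, hq, -, hqT⟩ := hcommon i
  obtain ⟨j, hj⟩ := Function.ne_iff.1 hq
  obtain ⟨q', hq', hqj', hqT'⟩ := hcommon j
  have hspan (v : σ → K) (hv : v ∈ V) : Submodule.span K {q, q'} = affineTangentSpace V v :=
    span_pair_eq_of_finrank_eq_two (hT v hv) (hqT v hv) (hqT' v hv)
      (linearIndependent_pair_of_apply_eq_zero hj hqj' hq')
  obtain ⟨v, hv, -⟩ := hplane q hq
  obtain ⟨h, hh, hh0⟩ := Submodule.exists_mem_ne_zero_of_ne_bot (p := conormalSpace V v) fun hbot =>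
    by
      have hrank := hT v hv
      rw [affineTangentSpace, finrank_dotOrthogonal, hbot, finrank_bot] at hrank
      omega
  obtain ⟨u, hu, hhu⟩ := hplane h hh0
  refine hhu (mem_conormalSpace_iff.1 hh u ?_)
  rw [← hspan v hv, hspan u hu]
  exact self_mem_affineTangentSpace hV hu

end DominantProjection

section PrincipalIdeals

theorem resultant_ne_zero_of_prime {R : Type*} [CommRing R] [IsDomain R]
    [UniqueFactorizationMonoid R] {P Q : Polynomial R} (hP : Prime P) (hdeg : P.natDegree ≠ 0)
    (hPQ : ¬ P ∣ Q) : P.resultant Q ≠ 0 := by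
  have : Nonempty (NormalizedGCDMonoid R) := inferInstance
  have := Classical.choice this
  have hprim : P.IsPrimitive := hP.irreducible.isPrimitive hdeg
  have hirr := (hprim.irreducible_iff_irreducible_map_fraction_map (K := FractionRing R)).1
    hP.irreducible
  have hcop := hirr.coprime_iff_not_dvd.2 fun hdvd =>
    hPQ ((hprim.dvd_iff_fraction_map_dvd_fraction_map (FractionRing R)).2 hdvd)
  have hinj := IsFractionRing.injective R (FractionRing R)
  intro hres
  refine (Polynomial.resultant_eq_zero_iff.1 ?_).2 hcop
  rw [Polynomial.natDegree_map_eq_of_injective hinj, Polynomial.natDegree_map_eq_of_injective hinj,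
    Polynomial.resultant_map_map, hres, map_zero]

variable {σ K : Type*} [Field K]

/-- Polynomials as univariate polynomials in the variable `X i`. -/
noncomputable def univariateEquiv [DecidableEq σ] (i : σ) :
    MvPolynomial σ K ≃ₐ[K] Polynomial (MvPolynomial {j // j ≠ i} K) :=
  (renameEquiv K (Equiv.optionSubtypeNe i).symm).trans (optionEquivLeft K _)

theorem univariateEquiv_rename [DecidableEq σ] (i : σ) (r : MvPolynomial {j // j ≠ i} K) :
    univariateEquiv i (rename Subtype.val r) = Polynomial.C r := by
  have hcomp : (univariateEquiv i : MvPolynomial σ K ≃ₐ[K] _).toAlgHom.comp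
      (rename Subtype.val) = Polynomial.CAlgHom := by
    ext1 j
    simp [univariateEquiv, optionEquivLeft_apply, j.2]
  exact congrArg (fun φ => φ r) hcomp

/-- The resultant, with respect to `X i`, of a prime element of the ideal and an element which is
not a multiple of it would be a nonzero element of the ideal without `X i`. -/
theorem exists_eq_span_singleton_of_isPrime (i : σ) (p : Ideal (MvPolynomial σ K)) [hp : p.IsPrime]
    (hi : ∀ r : MvPolynomial {j // j ≠ i} K, rename Subtype.val r ∈ p → r = 0) :
    ∃ Φ, p = Ideal.span {Φ} := by
  classical
  by_cases hbot : p = ⊥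
  · exact ⟨0, by simp [hbot]⟩
  let e : MvPolynomial σ K ≃ₐ[K] Polynomial (MvPolynomial {j // j ≠ i} K) := univariateEquiv i
  have he (r : MvPolynomial {j // j ≠ i} K) : e.symm (Polynomial.C r) = rename Subtype.val r :=
    e.symm_apply_eq.2 (univariateEquiv_rename i r).symm
  obtain ⟨Φ, hΦp, hΦ⟩ := hp.exists_mem_prime_of_ne_bot hbot
  have hdeg : (e Φ).natDegree ≠ 0 := fun hdeg => by
    obtain ⟨r, hr⟩ := Polynomial.natDegree_eq_zero.1 hdeg
    have hΦr : Φ = rename Subtype.val r := by rw [← he, hr, e.symm_apply_apply]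
    exact hΦ.ne_zero (by rw [hΦr, hi r (hΦr ▸ hΦp), map_zero])
  refine ⟨Φ, le_antisymm (fun g hg => ?_) ((Ideal.span_singleton_le_iff_mem p).2 hΦp)⟩
  rw [Ideal.mem_span_singleton]
  by_contra hdvd
  obtain ⟨a, b, -, -, hab⟩ := Polynomial.exists_mul_add_mul_eq_C_resultant (e Φ) (e g) le_rfl le_rfl
    (Or.inl hdeg)
  refine resultant_ne_zero_of_prime ((MulEquiv.prime_iff e).2 hΦ) hdeg
    (fun h => hdvd ((map_dvd_iff e).1 h)) (hi _ ?_)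
  rw [← he, ← hab, map_add, map_mul, map_mul, e.symm_apply_apply, e.symm_apply_apply]
  exact p.add_mem (p.mul_mem_right _ hΦp) (p.mul_mem_right _ hg)

end PrincipalIdeals

section Elimination

variable {σ τ K : Type*} [Field K]

/-- The ideal of the polynomial relations on a set of pairs `(h, x)`, written as polynomials in `x`
whose coefficients are polynomials in the parameter `h`. -/
noncomputable def relationIdeal (W : Set ((τ → K) × (σ → K))) :
    Ideal (MvPolynomial σ (MvPolynomial τ K)) :=
  ⨅ p ∈ W, RingHom.ker ((eval p.2).comp (MvPolynomial.map (eval p.1)))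

theorem mem_relationIdeal {W : Set ((τ → K) × (σ → K))} {F : MvPolynomial σ (MvPolynomial τ K)} :
    F ∈ relationIdeal W ↔ ∀ p ∈ W, eval p.2 (MvPolynomial.map (eval p.1) F) = 0 := by
  simp [relationIdeal, Submodule.mem_iInf, RingHom.mem_ker]

theorem eval_map_eval_map_C (h : τ → K) (x : σ → K) (f : MvPolynomial σ K) :
    eval x (MvPolynomial.map (eval h) (MvPolynomial.map C f)) = eval x f := by
  rw [MvPolynomial.map_map, show (eval h).comp C = RingHom.id K from RingHom.ext (eval_C (f := h)),
    MvPolynomial.map_id]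

theorem map_C_mem_relationIdeal {V : Set (σ → K)} {W : Set ((τ → K) × (σ → K))}
    (hW : ∀ p ∈ W, p.2 ∈ V) {f : MvPolynomial σ K} (hf : f ∈ vanishingIdeal K V) :
    MvPolynomial.map C f ∈ relationIdeal W :=
  mem_relationIdeal.2 fun p hp => by
    rw [eval_map_eval_map_C]
    exact mem_vanishingIdeal_iff_eval.1 hf _ (hW p hp)

theorem map_homogeneousComponent {R S : Type*} [CommSemiring R] [CommSemiring S] (φ : R →+* S)
    (n : ℕ) (F : MvPolynomial σ R) :
    MvPolynomial.map φ (homogeneousComponent n F) =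
      homogeneousComponent n (MvPolynomial.map φ F) := by
  classical
  ext m
  simp only [coeff_map, coeff_homogeneousComponent, apply_ite φ, map_zero]

theorem homogeneousComponent_mem_relationIdeal [Infinite K] {W : Set ((τ → K) × (σ → K))}
    (hW : ∀ h x, (h, x) ∈ W → ∀ c : K, c ≠ 0 → (h, c • x) ∈ W)
    {F : MvPolynomial σ (MvPolynomial τ K)} (hF : F ∈ relationIdeal W) (n : ℕ) :
    homogeneousComponent n F ∈ relationIdeal W := by
  rw [mem_relationIdeal] at hF ⊢
  rintro ⟨h, x⟩ hp
  rw [map_homogeneousComponent]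
  exact eval_homogeneousComponent_eq_zero (fun c hc => hF (h, c • x) (hW h x hp c hc)) n

theorem exists_pow_idealOfVars_le [Finite σ] [IsAlgClosed K] (I : Ideal (MvPolynomial σ K))
    (hI : ∀ x : σ → K, x ≠ 0 → ∃ f ∈ I, eval x f ≠ 0) : ∃ n, idealOfVars σ K ^ n ≤ I := by
  refine Ideal.exists_pow_le_of_le_radical_of_fg ?_ (idealOfVars_fg σ K)
  rw [idealOfVars, Ideal.span_le, ← vanishingIdeal_zeroLocus_eq_radical (K := K)]
  rintro _ ⟨i, rfl⟩
  rw [SetLike.mem_coe, mem_vanishingIdeal_iff_eval]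
  intro x hx
  rw [eval_X]
  by_contra hxi
  obtain ⟨f, hf, hfx⟩ := hI x (Function.ne_iff.2 ⟨i, hxi⟩)
  exact hfx (by simpa using hx f hf)

theorem mem_smul_homogeneousSubmodule {R : Type*} [CommRing R] {I : Ideal R} {n : ℕ}
    {F : MvPolynomial σ R} (hF : F.IsHomogeneous n) (hFI : ∀ m, coeff m F ∈ I) :
    F ∈ I • homogeneousSubmodule σ R n := by
  rw [F.as_sum]
  refine Submodule.sum_mem _ fun m hm => ?_
  rw [← mul_one (coeff m F), ← smul_eq_mul, ← smul_monomial]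
  refine Submodule.smul_mem_smul (hFI m) (isHomogeneous_monomial _ ?_)
  rw [Finsupp.degree_eq_weight_one]
  exact hF (mem_support_iff.1 hm)

theorem homogeneousSubmodule_le_relationIdeal_sup [Infinite K] {W : Set ((τ → K) × (σ → K))}
    (hW : ∀ h x, (h, x) ∈ W → ∀ c : K, c ≠ 0 → (h, c • x) ∈ W) {h₀ : τ → K} {n : ℕ}
    (hn : idealOfVars σ K ^ n ≤ (relationIdeal W).map (MvPolynomial.map (eval h₀))) :
    homogeneousSubmodule σ (MvPolynomial τ K) n ≤ (relationIdeal W).restrictScalars _ ⊔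
      RingHom.ker (eval h₀) • homogeneousSubmodule σ (MvPolynomial τ K) n := by
  let spec : MvPolynomial σ (MvPolynomial τ K) →+* MvPolynomial σ K := MvPolynomial.map (eval h₀)
  have hspec : Function.Surjective spec := map_surjective _ fun c => ⟨C c, eval_C c⟩
  intro G hG
  have hGn : spec G ∈ idealOfVars σ K ^ n := by
    rw [mem_pow_idealOfVars_iff']
    exact fun m hm => (IsHomogeneous.map hG _).coeff_eq_zero hm.ne
  obtain ⟨F, hF, hFG⟩ := (Ideal.mem_map_iff_of_surjective _ hspec).1 (hn hGn)
  have hcomp : G - homogeneousComponent n F ∈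
      RingHom.ker (eval h₀) • homogeneousSubmodule σ (MvPolynomial τ K) n := by
    refine mem_smul_homogeneousSubmodule (hG.sub (homogeneousComponent_isHomogeneous n F))
      fun m => ?_
    rw [RingHom.mem_ker, ← coeff_map, map_sub, map_homogeneousComponent]
    change coeff m (spec G - homogeneousComponent n (spec F)) = 0
    rw [hFG, homogeneousComponent_eq_self (IsHomogeneous.map hG _), sub_self, coeff_zero]
  rw [← add_sub_cancel (homogeneousComponent n F) G]
  exact Submodule.add_mem_sup (homogeneousComponent_mem_relationIdeal hW hF n) hcomp

/-- Elimination theory: by the Nullstellensatz and Nakayama's lemma, some `D` with `D h₀ ≠ 0`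
multiplies the monomials of a high degree into the ideal of relations. -/
theorem exists_eval_ne_zero_of_forall_relation [Finite σ] [IsAlgClosed K]
    {W : Set ((τ → K) × (σ → K))}
    (hW : ∀ h x, (h, x) ∈ W → ∀ c : K, c ≠ 0 → (h, c • x) ∈ W) (hW0 : ∀ h, (h, 0) ∉ W)
    (h₀ : τ → K) (hh₀ : ∀ x : σ → K, x ≠ 0 → ∃ F ∈ relationIdeal W,
      eval x (MvPolynomial.map (eval h₀) F) ≠ 0) :
    ∃ D : MvPolynomial τ K, (∀ p ∈ W, eval p.1 D = 0) ∧ eval h₀ D ≠ 0 := by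
  obtain ⟨n, hn⟩ := exists_pow_idealOfVars_le
      ((relationIdeal W).map (MvPolynomial.map (eval h₀))) fun x hx => by
    obtain ⟨F, hF, hFx⟩ := hh₀ x hx
    exact ⟨_, Ideal.mem_map_of_mem _ hF, hFx⟩
  obtain ⟨D, hD, hDJ⟩ := Submodule.exists_sub_one_mem_and_smul_le_of_fg_of_le_sup
    (homogeneousSubmodule_fg σ _ n) le_rfl
    (homogeneousSubmodule_le_relationIdeal_sup hW hn)
  have hD1 : eval h₀ D = 1 := by simpa [sub_eq_zero, RingHom.mem_ker] using hD
  refine ⟨D, ?_, by simp [hD1]⟩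
  rintro ⟨h, x⟩ hp
  obtain ⟨i, hi : x i ≠ 0⟩ := Function.ne_iff.1 fun hx : x = 0 => hW0 h (hx ▸ hp)
  have hmem : D • X i ^ n ∈ relationIdeal W :=
    hDJ (Submodule.smul_mem_pointwise_smul _ D _ (isHomogeneous_X_pow i n))
  simpa [smul_eq_C_mul, hi] using mem_relationIdeal.1 hmem _ hp

end Elimination

section Dual

universe u

section Fintype

variable {σ ι K : Type u} [Fintype σ] [Fintype ι] [Field K] {V : Set (σ → K)}

theorem exists_mem_vanishingIdeal_totalSpace [CharZero K] [(vanishingIdeal K V).IsPrime]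
    {E : (σ → K) → Submodule K (ι → K)} (hE : GloballyGenerated V E) (hV : IsConical V) {i : σ}
    (hi : X i ∉ vanishingIdeal K V) (hsmul : ∀ c : K, c ≠ 0 → ∀ v, E (c • v) = E v) {k : ℕ}
    (hk : ∀ v ∈ V, Module.finrank K (E v) = k)
    (hconormal : ∀ v ∈ V,
      Fintype.card σ + k ≤ Fintype.card ι + Module.finrank K (conormalSpace V v)) :
    ∃ G ≠ 0, G ∈ vanishingIdeal K (totalSpace V E) := by
  obtain ⟨v, hv, hvi⟩ := exists_mem_apply_ne_zero hi
  have hle := trdeg_chart_add_finrank_conormalSpace_le hV (inv_smul_mem_chart hV hv hvi)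
  rw [conormalSpace_smul hV _ (inv_ne_zero hvi)] at hle
  obtain ⟨n, hn⟩ := Cardinal.lt_aleph0.1
    ((self_le_add_right _ _).trans_lt (hle.trans_lt Cardinal.natCast_lt_aleph0))
  refine hE.exists_equation hV hi hsmul hk ?_
  rw [hn] at hle ⊢
  norm_cast at hle ⊢
  have := hconormal v hv
  omega

theorem exists_prime_vanishingIdeal_dualCone_eq_span [IsAlgClosed K] [CharZero K]
    [(vanishingIdeal K V).IsPrime] (hV : IsConical V)
    (hT : ∀ v ∈ V, Module.finrank K (affineTangentSpace V v) = 2) (hcard : 2 < Fintype.card σ)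
    (hplane : ∀ h : σ → K, h ≠ 0 → ∃ v ∈ V, h ⬝ᵥ v ≠ 0) :
    ∃ Φ : MvPolynomial σ K, Φ.IsHomogeneous Φ.totalDegree ∧ Prime Φ ∧
      vanishingIdeal K (dualCone V) = Ideal.span {Φ} := by
  classical
  obtain ⟨i, hi⟩ := exists_forall_eq_zero_of_mem_vanishingIdeal_conormal hV hT hcard hplane
  have hXi : X i ∉ vanishingIdeal K V := fun h => by
    obtain ⟨v, hv, hne⟩ := hplane (Pi.single i 1) (by simp)
    exact hne (by simpa using mem_vanishingIdeal_iff_eval.1 h v hv)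
  obtain ⟨v, hv, -⟩ := exists_mem_apply_ne_zero hXi
  have hprime := isPrime_vanishingIdeal_totalSpace ⟨v, hv⟩
    (globallyGenerated_conormalSpace (V := V))
  obtain ⟨Φ, hΦ⟩ := exists_eq_span_singleton_of_isPrime i (vanishingIdeal K (dualCone V))
    fun r hr => rename_injective _ Subtype.val_injective <| by
      rw [map_zero]
      refine hi _ hr fun x t => ?_
      rw [eval_rename, eval_rename]
      congr 2
      ext j
      simp [j.2]
  have hconormal (v : σ → K) (hv : v ∈ V) :
      Module.finrank K (conormalSpace V v) = Fintype.card σ - 2 := by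
    rw [finrank_conormalSpace, hT v hv]
  obtain ⟨G, hG0, hG⟩ := exists_mem_vanishingIdeal_totalSpace globallyGenerated_conormalSpace hV
    hXi (conormalSpace_smul hV) hconormal fun v hv => (by rw [hconormal v hv])
  have hΦ0 : Φ ≠ 0 := fun h => hG0 (by simpa [hΦ, h] using hG)
  refine ⟨Φ, isHomogeneous_of_span_singleton (hΦ ▸ isHomogeneous_vanishingIdeal
    isConical_totalSpace), (Ideal.span_singleton_prime hΦ0).1 (hΦ ▸ hprime), hΦ⟩

end Fintype

theorem mem_dualCone_of_forall_eval_eq_zero {σ K : Type u} [Finite σ] [Field K]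
    [IsAlgClosed K] {V : Set (σ → K)} [(vanishingIdeal K V).IsPrime] (hV : IsConical V)
    (hV0 : 0 ∉ V)
    (hclosed : ∀ x : σ → K, x ≠ 0 → x ∉ V → ∃ f ∈ vanishingIdeal K V, eval x f ≠ 0) {k : ℕ}
    (hk : ∀ v ∈ V, Module.finrank K (conormalSpace V v) = k) {h₀ : σ → K}
    (hh₀ : ∀ D ∈ vanishingIdeal K (dualCone V), eval h₀ D = 0) : h₀ ∈ dualCone V := by
  cases nonempty_fintype σ
  by_contra hcon
  let W : Set ((σ → K) × (σ → K)) := {p | p.2 ∈ V ∧ p.1 ∈ conormalSpace V p.2}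
  obtain ⟨D, hD, hD0⟩ := exists_eval_ne_zero_of_forall_relation (W := W)
    (fun h x hx c hc => ⟨hV x hx.1 c hc, (conormalSpace_smul hV c hc x).symm ▸ hx.2⟩)
    (fun h h0 => hV0 h0.1) h₀ fun x hx => by
      by_cases hxV : x ∈ V
      · obtain ⟨w, hw, hhw⟩ : ∃ w ∈ affineTangentSpace V x, h₀ ⬝ᵥ w ≠ 0 := by
          by_contra! hall
          exact hcon ⟨x, hxV, mem_conormalSpace_iff.2 hall⟩
        obtain ⟨T, hT, rfl⟩ := globallyGenerated_conormalSpace.dotOrthogonal hk x hxV w hw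
        have heval (h u : σ → K) : eval u (MvPolynomial.map (eval h)
            (∑ i, C (X i) * MvPolynomial.map C (T i))) = h ⬝ᵥ evalField u T := by
          simp only [map_sum, map_mul, map_C, eval_C, eval_X, eval_map_eval_map_C]
          rfl
        refine ⟨_, mem_relationIdeal.2 fun p hp => ?_, (heval h₀ x).trans_ne hhw⟩
        rw [heval]
        exact mem_conormalSpace_iff.1 hp.2 _ (hT p.2 hp.1)
      · obtain ⟨f, hf, hfx⟩ := hclosed x hx hxV
        exact ⟨_, map_C_mem_relationIdeal (fun p hp => hp.1) hf, by rwa [eval_map_eval_map_C]⟩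
  refine hD0 (hh₀ D (mem_vanishingIdeal_iff_eval.2 ?_))
  rintro h ⟨v, hv, hh⟩
  exact hD (h, v) ⟨hv, hh⟩

end Dual

section DifferentialIdeals

variable {σ K : Type*} [Finite σ] [Field K] [CharZero K]

/-- The Taylor expansion at `x` of an element of the ideal vanishes. -/
theorem eq_bot_of_forall_pderiv_mem {I : Ideal (MvPolynomial σ K)}
    (hI : ∀ f ∈ I, ∀ i, pderiv i f ∈ I) {x : σ → K} (hx : ∀ f ∈ I, eval x f = 0) : I = ⊥ := by
  cases nonempty_fintype σ
  have hcoeff (v : σ → K) (n : ℕ) : ∀ f ∈ I, (restrictLine x v f).coeff n = 0 := by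
    induction n with
    | zero =>
      intro f hf
      rw [Polynomial.coeff_zero_eq_eval_zero, eval_restrictLine, zero_smul, add_zero]
      exact hx f hf
    | succ n ih =>
      intro f hf
      have hder := congrArg (Polynomial.coeff · n) (derivative_restrictLine x v f)
      simp only [Polynomial.coeff_derivative, Polynomial.finsetSum_coeff, Polynomial.coeff_mul_C,
        ih _ (hI f hf _), zero_mul, Finset.sum_const_zero] at hder
      exact (mul_eq_zero.1 hder).resolve_right (Nat.cast_add_one_ne_zero n)
  refine (Submodule.eq_bot_iff I).2 fun f hf => MvPolynomial.funext fun y => ?_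
  have hzero : restrictLine x (y - x) f = 0 :=
    Polynomial.ext fun n => hcoeff (y - x) n f hf
  have hy := eval_restrictLine x (y - x) f 1
  rw [one_smul, add_sub_cancel, hzero, Polynomial.eval_zero] at hy
  rw [map_zero]
  exact hy.symm

theorem exists_pderiv_notMem_vanishingIdeal {W : Set (σ → K)} (hW : W.Nonempty)
    (hbot : vanishingIdeal K W ≠ ⊥) :
    ∃ f ∈ vanishingIdeal K W, ∃ j, pderiv j f ∉ vanishingIdeal K W := by
  obtain ⟨x, hx⟩ := hW
  by_contra! h
  exact hbot (eq_bot_of_forall_pderiv_mem h fun f hf => mem_vanishingIdeal_iff_eval.1 hf x hx)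

end DifferentialIdeals

section Discriminant

variable {σ R A B : Type*} [CommRing R] [CommRing A] [Algebra R A] [CommRing B] [Algebra R B]

/-- The discriminant, up to sign and a power of the leading coefficient, of the restriction of `f`
to the line `s ↦ u + s v`. The restriction is regarded as a polynomial of degree
`f.totalDegree`, so that the discriminant is polynomial in `u` and `v`. -/
noncomputable def lineDiscriminant (u v : σ → A) (f : MvPolynomial σ R) : A :=
  (restrictLine u v f).resultant (Polynomial.derivative (restrictLine u v f)) f.totalDegree
    (f.totalDegree - 1)

theorem map_lineDiscriminant (φ : A →ₐ[R] B) (u v : σ → A) (f : MvPolynomial σ R) :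
    φ (lineDiscriminant u v f) = lineDiscriminant (φ ∘ u) (φ ∘ v) f := by
  rw [lineDiscriminant, lineDiscriminant, ← map_restrictLine, Polynomial.derivative_map,
    Polynomial.resultant_map_map]
  rfl

theorem eval_lineDiscriminant {τ : Type*} (x : τ → R) (u v : σ → MvPolynomial τ R)
    (f : MvPolynomial σ R) :
    eval x (lineDiscriminant u v f) = lineDiscriminant (evalField x u) (evalField x v) f :=
  map_lineDiscriminant (aeval x) u v f

theorem natDegree_restrictLine {u v : σ → A} {f : MvPolynomial σ R}
    (hf : f.IsHomogeneous f.totalDegree) (hv : aeval v f ≠ 0) :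
    (restrictLine u v f).natDegree = f.totalDegree :=
  (natDegree_restrictLine_le u v f).antisymm
    (Polynomial.le_natDegree_of_ne_zero (by rwa [coeff_restrictLine u v hf]))

/-- The automorphism `p(x, s) ↦ p(x + s v, s)`. -/
noncomputable def translateEquiv (v : σ → R) :
    Polynomial (MvPolynomial σ R) ≃ₐ[R] Polynomial (MvPolynomial σ R) :=
  AlgEquiv.ofAlgHom
    (Polynomial.eval₂AlgHom (restrictLine X (C ∘ v)) Polynomial.X fun _ => Commute.all _ _)
    (Polynomial.eval₂AlgHom (restrictLine X (C ∘ (-v))) Polynomial.X fun _ => Commute.all _ _)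
    (by ext <;> simp [restrictLine])
    (by ext <;> simp [restrictLine])

theorem translateEquiv_C (v : σ → R) (f : MvPolynomial σ R) :
    translateEquiv v (Polynomial.C f) = restrictLine X (C ∘ v) f :=
  Polynomial.eval₂_C _ _

theorem prime_restrictLine_X {f : MvPolynomial σ R} (hf : Prime f) (v : σ → R) :
    Prime (restrictLine X (C ∘ v) f : Polynomial (MvPolynomial σ R)) := by
  rw [← translateEquiv_C, MulEquiv.prime_iff]
  exact Polynomial.prime_C_iff.2 hf

end Discriminant

section SeparableLines

variable {σ K : Type*} [Field K]

theorem totalDegree_ne_zero_of_prime {f : MvPolynomial σ K} (hf : Prime f) :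
    f.totalDegree ≠ 0 := by
  intro h
  obtain ⟨c, rfl⟩ : ∃ c, f = C c := ⟨_, totalDegree_eq_zero_iff_eq_C.1 h⟩
  exact hf.not_isUnit ((isUnit_iff_ne_zero.2 fun hc => hf.ne_zero (by rw [hc, C_0])).map C)

theorem separable_restrictLine {u v : σ → K} {f : MvPolynomial σ K} (hf : f.totalDegree ≠ 0)
    (h : lineDiscriminant u v f ≠ 0) : (restrictLine u v f).Separable := by
  have hdeg := natDegree_restrictLine_le u v f
  obtain ⟨a, b, -, -, hab⟩ := Polynomial.exists_mul_add_mul_eq_C_resultant (restrictLine u v f)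
    (Polynomial.derivative (restrictLine u v f)) hdeg
    ((Polynomial.natDegree_derivative_le _).trans (Nat.sub_le_sub_right hdeg 1)) (Or.inl hf)
  have hinv : Polynomial.C (lineDiscriminant u v f)⁻¹ * Polynomial.C (lineDiscriminant u v f) =
      1 := by
    rw [← Polynomial.C_mul, inv_mul_cancel₀ h, Polynomial.C_1]
  refine ⟨Polynomial.C (lineDiscriminant u v f)⁻¹ * a,
    Polynomial.C (lineDiscriminant u v f)⁻¹ * b, ?_⟩
  rw [lineDiscriminant] at hinv ⊢
  linear_combination Polynomial.C _ * hab + hinv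

theorem lineDiscriminant_X_ne_zero [CharZero K] {f : MvPolynomial σ K}
    (hf : f.IsHomogeneous f.totalDegree) (hprime : Prime f) {v : σ → K} (hv : eval v f ≠ 0) :
    (lineDiscriminant X (C ∘ v) f : MvPolynomial σ K) ≠ 0 := by
  have hvC : aeval (C ∘ v : σ → MvPolynomial σ K) f ≠ 0 := by
    have h : aeval (C ∘ v : σ → MvPolynomial σ K) f = C (eval v f) :=
      aeval_algebraMap_apply (MvPolynomial σ K) v f
    rwa [h, Ne, C_eq_zero]
  have hdeg := natDegree_restrictLine (u := X) hf hvC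
  have hd : (restrictLine X (C ∘ v) f : Polynomial (MvPolynomial σ K)).natDegree ≠ 0 := by
    rw [hdeg]
    exact totalDegree_ne_zero_of_prime hprime
  have hdvd : ¬ (restrictLine X (C ∘ v) f : Polynomial (MvPolynomial σ K)) ∣
      Polynomial.derivative (restrictLine X (C ∘ v) f) := fun h =>
    (Polynomial.natDegree_derivative_lt hd).not_ge
      (Polynomial.natDegree_le_of_dvd h fun h0 => hd (Polynomial.derivative_eq_zero.1 h0))
  rw [lineDiscriminant, ← hdeg, ← Polynomial.natDegree_derivative]
  exact resultant_ne_zero_of_prime (prime_restrictLine_X hprime v) hd hdvd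

theorem exists_lineDiscriminant_ne_zero [CharZero K] {f : MvPolynomial σ K}
    (hf : f.IsHomogeneous f.totalDegree) (hprime : Prime f) :
    ∃ u v : σ → K, eval v f ≠ 0 ∧ lineDiscriminant u v f ≠ 0 := by
  obtain ⟨v, hv⟩ : ∃ v, eval v f ≠ 0 := by
    by_contra! h
    exact hprime.ne_zero (MvPolynomial.funext fun x => by rw [h, map_zero])
  obtain ⟨u, hu⟩ : ∃ u, eval u (lineDiscriminant X (C ∘ v) f : MvPolynomial σ K) ≠ 0 := by
    by_contra! h
    exact lineDiscriminant_X_ne_zero hf hprime hv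
      (MvPolynomial.funext fun x => by rw [h, map_zero])
  refine ⟨u, v, hv, ?_⟩
  have hX : evalField u (X : σ → MvPolynomial σ K) = u := funext fun i => eval_X i
  have hC : evalField u (C ∘ v : σ → MvPolynomial σ K) = v := funext fun i => eval_C (v i)
  rwa [eval_lineDiscriminant, hX, hC] at hu

variable [Fintype σ]

theorem exists_ne_zero_dotProduct_eq_zero (hcard : 2 < Fintype.card σ) (u v : σ → K) :
    ∃ o ≠ 0, u ⬝ᵥ o = 0 ∧ v ⬝ᵥ o = 0 := by
  have hker := LinearMap.ker_ne_bot_of_finrank_lt (f := (Matrix.of ![u, v]).mulVecLin)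
    (by simpa using hcard)
  obtain ⟨o, ho, ho0⟩ := Submodule.exists_mem_ne_zero_of_ne_bot hker
  rw [LinearMap.mem_ker, Matrix.mulVecLin_apply] at ho
  exact ⟨o, ho0, congrFun ho 0, congrFun ho 1⟩

/-- The polynomial vector field whose value at `o` is `o i` times the projection of `h` onto the
orthogonal space of `o` along the `i`-th coordinate vector. -/
noncomputable def orthogonalField [DecidableEq σ] (i : σ) (h : σ → K) :
    σ → MvPolynomial σ K := fun j =>
  X i * C (h j) - linearForm h * C ((Pi.single i 1 : σ → K) j)

theorem evalField_orthogonalField [DecidableEq σ] (i : σ) (h o : σ → K) :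
    evalField o (orthogonalField i h) = o i • h - (h ⬝ᵥ o) • Pi.single i 1 := by
  ext j
  simp [evalField, orthogonalField, eval_linearForm]

theorem evalField_orthogonalField_dotProduct [DecidableEq σ] (i : σ) (h o : σ → K) :
    evalField o (orthogonalField i h) ⬝ᵥ o = 0 := by
  simp [evalField_orthogonalField, sub_dotProduct, smul_dotProduct, mul_comm]

theorem exists_separable_orthogonal_line [CharZero K] {f : MvPolynomial σ K}
    (hf : f.IsHomogeneous f.totalDegree) (hprime : Prime f) (hcard : 2 < Fintype.card σ) :
    ∃ G : MvPolynomial σ K, G ≠ 0 ∧ ∀ o, eval o G ≠ 0 → ∃ u v, u ⬝ᵥ o = 0 ∧ v ⬝ᵥ o = 0 ∧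
      eval v f ≠ 0 ∧ (restrictLine u v f).Separable := by
  classical
  obtain ⟨u, v, hv, huv⟩ := exists_lineDiscriminant_ne_zero hf hprime
  obtain ⟨o, ho0, huo, hvo⟩ := exists_ne_zero_dotProduct_eq_zero hcard u v
  obtain ⟨i, hi⟩ := Function.ne_iff.1 ho0
  let U := orthogonalField i u
  let W := orthogonalField i v
  have heval (x : σ → K) : eval x (lineDiscriminant U W f * aeval W f) =
      lineDiscriminant (evalField x U) (evalField x W) f * eval (evalField x W) f := by
    rw [map_mul, eval_evalField, eval_lineDiscriminant]
  refine ⟨lineDiscriminant U W f * aeval W f, fun h0 => ?_, fun x hx => ?_⟩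
  · have hfix (h : σ → K) (hh : h ⬝ᵥ o = 0) :
        evalField ((o i)⁻¹ • o) (orthogonalField i h) = h := by
      simp [evalField_orthogonalField, hh, inv_mul_cancel₀ hi]
    have h := heval ((o i)⁻¹ • o)
    rw [h0, map_zero, hfix u huo, hfix v hvo] at h
    exact mul_ne_zero huv hv h.symm
  · rw [heval] at hx
    exact ⟨_, _, evalField_orthogonalField_dotProduct i u x,
      evalField_orthogonalField_dotProduct i v x, right_ne_zero_of_mul hx,
      separable_restrictLine (totalDegree_ne_zero_of_prime hprime) (left_ne_zero_of_mul hx)⟩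

end SeparableLines

section Squarefree

theorem squarefree_of_squarefree_restrictLine {σ K : Type*} [Field K] {u v : σ → K}
    {f : MvPolynomial σ K} (hdeg : f.totalDegree ≤ (restrictLine u v f).natDegree)
    (hf : Squarefree (restrictLine u v f)) : Squarefree f := by
  have hf0 : f ≠ 0 := fun h => hf.ne_zero (by rw [h, map_zero])
  rintro q ⟨k, rfl⟩
  have hq0 : q ≠ 0 := left_ne_zero_of_mul (left_ne_zero_of_mul hf0)
  have hq : (restrictLine u v q).natDegree = 0 := Polynomial.natDegree_eq_zero_of_isUnit
    (hf _ ⟨restrictLine u v k, by rw [map_mul, map_mul]⟩)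
  rw [totalDegree_mul_of_isDomain (mul_ne_zero hq0 hq0) (right_ne_zero_of_mul hf0),
    totalDegree_mul_of_isDomain hq0 hq0, map_mul, map_mul] at hdeg
  have hqk := Polynomial.natDegree_mul_le (p := restrictLine u v q * restrictLine u v q)
    (q := restrictLine u v k)
  have hqq := Polynomial.natDegree_mul_le (p := restrictLine u v q) (q := restrictLine u v q)
  have hk := natDegree_restrictLine_le u v k
  obtain ⟨c, rfl⟩ : ∃ c, q = C c := ⟨_, totalDegree_eq_zero_iff_eq_C.1 (by omega)⟩
  exact (isUnit_iff_ne_zero.2 fun hc => hq0 (by rw [hc, C_0])).map C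

end Squarefree

theorem finrank_map_of_disjoint_ker {K E F : Type*} [Field K] [AddCommGroup E] [Module K E]
    [AddCommGroup F] [Module K F] {T : Submodule K E} {f : E →ₗ[K] F}
    (hf : Disjoint T (LinearMap.ker f)) : Module.finrank K (T.map f) = Module.finrank K T := by
  rw [← LinearMap.range_domRestrict]
  exact LinearMap.finrank_range_of_inj
    (Set.injOn_iff_injective.1 (LinearMap.disjoint_ker_iff_injOn.1 hf))

section LinearProjection

universe u

variable {σ ι τ K : Type u} [Field K] {V : Set (σ → K)}

theorem globallyGenerated_span_singleton : GloballyGenerated V fun v => K ∙ v := by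
  intro v _ w hw
  obtain ⟨c, rfl⟩ := Submodule.mem_span_singleton.1 hw
  have heval (u : σ → K) : evalField u (fun i => C c * X i) = c • u := by
    ext i
    simp [evalField]
  refine ⟨fun i => C c * X i, fun u _ => ?_, heval v⟩
  rw [heval]
  exact Submodule.smul_mem _ c (Submodule.mem_span_singleton_self u)

theorem GloballyGenerated.map [Fintype ι] {E : (σ → K) → Submodule K (ι → K)}
    (hE : GloballyGenerated V E) (M : Matrix τ ι K) :
    GloballyGenerated V fun v => (E v).map M.mulVecLin := by
  rintro v hv _ ⟨w, hw, rfl⟩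
  obtain ⟨W, hW, rfl⟩ := hE v hv w hw
  have heval (u : σ → K) : evalField u (M.map (C (σ := σ)) *ᵥ W) = M *ᵥ evalField u W := by
    rw [evalField_mulVec]
    congr 1
    ext
    simp
  refine ⟨M.map C *ᵥ W, fun u hu => ?_, heval v⟩
  rw [heval]
  exact Submodule.mem_map_of_mem (hW u hu)

variable [Fintype σ] {M : Matrix τ σ K}

theorem vanishingIdeal_image_eq_comap :
    vanishingIdeal K (M.mulVecLin '' V) = (vanishingIdeal K V).comap (compMulVec M) := by
  ext f
  simp only [Ideal.mem_comap, mem_vanishingIdeal_iff_eval, Set.forall_mem_image, eval_compMulVec,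
    Matrix.mulVecLin_apply]

variable [Fintype τ]

theorem vanishingIdeal_image_ne_bot [CharZero K] [(vanishingIdeal K V).IsPrime] (hV : IsConical V)
    (hM : ∀ v ∈ V, M *ᵥ v ≠ 0)
    (hcard : ∀ v ∈ V, Module.finrank K (affineTangentSpace V v) < Fintype.card τ) :
    vanishingIdeal K (M.mulVecLin '' V) ≠ ⊥ := by
  obtain ⟨v₀, hv₀⟩ : V.Nonempty := Set.nonempty_iff_ne_empty.2 fun h =>
    ‹(vanishingIdeal K V).IsPrime›.ne_top (h ▸ vanishingIdeal_empty)
  obtain ⟨i, hi⟩ := Function.ne_iff.1 fun h : v₀ = 0 => hM v₀ hv₀ (by simp [h])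
  obtain ⟨G, hG0, hG⟩ := exists_mem_vanishingIdeal_totalSpace (k := 1) (i := i)
    (globallyGenerated_span_singleton.map M) hV
    (fun h => hi (by simpa using mem_vanishingIdeal_iff_eval.1 h v₀ hv₀))
    (fun c hc v => by rw [Submodule.span_singleton_smul_eq hc.isUnit])
    (fun v hv => by
      rw [Submodule.map_span, Set.image_singleton]
      exact finrank_span_singleton (hM v hv))
    fun v hv => by
      have := hcard v hv
      rw [affineTangentSpace, finrank_dotOrthogonal] at this
      omega
  refine fun hbot => hG0 (Ideal.mem_bot.1 (hbot ▸ vanishingIdeal_anti_mono ?_ hG))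
  rintro _ ⟨v, hv, rfl⟩
  exact ⟨v, hv, Submodule.mem_map_of_mem (Submodule.mem_span_singleton_self v)⟩

theorem mem_dotOrthogonal_map_affineTangentSpace {v : σ → K} {l : τ → K} :
    l ∈ dotOrthogonal ((affineTangentSpace V v).map M.mulVecLin) ↔
      l ᵥ* M ∈ conormalSpace V v := by
  rw [mem_dotOrthogonal, mem_conormalSpace_iff]
  refine Set.forall_mem_image.trans (forall₂_congr fun w _ => ?_)
  rw [dotProduct_comm, ← Matrix.dotProduct_mulVec]
  rfl

theorem vecMul_mem_conormalSpace {v : σ → K} {l : τ → K}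
    (hl : l ∈ conormalSpace (M.mulVecLin '' V) (M *ᵥ v)) : l ᵥ* M ∈ conormalSpace V v := by
  refine mem_conormalSpace_iff.2 fun w hw => ?_
  rw [← Matrix.dotProduct_mulVec]
  exact mem_conormalSpace_iff.1 hl _
    (mulVec_mem_affineTangentSpace (fun u hu => Set.mem_image_of_mem M.mulVecLin hu) hw)

theorem conormalSpace_image_le {v : σ → K} : conormalSpace (M.mulVecLin '' V) (M *ᵥ v) ≤
    dotOrthogonal ((affineTangentSpace V v).map M.mulVecLin) := fun _ hl =>
  mem_dotOrthogonal_map_affineTangentSpace.2 (vecMul_mem_conormalSpace hl)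

theorem finrank_dotOrthogonal_map_affineTangentSpace {v : σ → K}
    (hM : Disjoint (affineTangentSpace V v) (LinearMap.ker M.mulVecLin)) :
    Module.finrank K (dotOrthogonal ((affineTangentSpace V v).map M.mulVecLin)) =
      Fintype.card τ - Module.finrank K (affineTangentSpace V v) := by
  rw [finrank_dotOrthogonal, finrank_map_of_disjoint_ker hM]

/-- Here `τ` has one more element than the tangent spaces have dimensions, so that the hyperplane
spanned by the image of the tangent space is the only candidate for a tangent hyperplane. -/
theorem mem_conormalSpace_image_iff {v : σ → K}
    (hM : Disjoint (affineTangentSpace V v) (LinearMap.ker M.mulVecLin))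
    (hcard : Fintype.card τ = Module.finrank K (affineTangentSpace V v) + 1)
    (hbot : conormalSpace (M.mulVecLin '' V) (M *ᵥ v) ≠ ⊥) {l : τ → K} :
    l ∈ conormalSpace (M.mulVecLin '' V) (M *ᵥ v) ↔ l ᵥ* M ∈ conormalSpace V v := by
  rw [← mem_dotOrthogonal_map_affineTangentSpace,
    Submodule.eq_of_le_of_finrank_le (conormalSpace_image_le (M := M))]
  rw [finrank_dotOrthogonal_map_affineTangentSpace hM, hcard, Nat.add_sub_cancel_left]
  exact Submodule.one_le_finrank_iff.2 hbot

/-- Where the image has a non-zero conormal vector, its conormal space is cut out by that of `V`;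
these points are dense, and global generation spreads the equations to the whole family. -/
theorem vanishingIdeal_dualCone_image [CharZero K] [hp : (vanishingIdeal K V).IsPrime]
    (hV : IsConical V) (hV0 : 0 ∉ V) {k : ℕ}
    (hk : ∀ v ∈ V, Module.finrank K (affineTangentSpace V v) = k)
    (hM : ∀ v ∈ V, Disjoint (affineTangentSpace V v) (LinearMap.ker M.mulVecLin))
    (hcard : Fintype.card τ = k + 1) :
    vanishingIdeal K (dualCone (M.mulVecLin '' V)) =
      vanishingIdeal K {l | l ᵥ* M ∈ dualCone V} := by
  refine le_antisymm (fun f hf => mem_vanishingIdeal_iff_eval.2 ?_) (vanishingIdeal_anti_mono ?_)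
  · rintro l ⟨v, hv, hl⟩
    have hMV : ∀ u ∈ V, M *ᵥ u ≠ 0 := fun u hu h0 => hV0 <|
      Submodule.disjoint_def.1 (hM u hu) u (self_mem_affineTangentSpace hV hu) h0 ▸ hu
    obtain ⟨g, hg, j, hgj⟩ := exists_pderiv_notMem_vanishingIdeal (Set.image_nonempty.2 ⟨v, hv⟩)
      (vanishingIdeal_image_ne_bot hV hMV fun u hu => by rw [hk u hu, hcard]; exact k.lt_succ_self)
    rw [vanishingIdeal_image_eq_comap, Ideal.mem_comap] at hgj
    have hgen : GloballyGenerated V fun u =>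
        dotOrthogonal ((affineTangentSpace V u).map M.mulVecLin) := by
      have hT : GloballyGenerated V (affineTangentSpace V) :=
        globallyGenerated_conormalSpace.dotOrthogonal fun u hu => by
          rw [finrank_conormalSpace, hk u hu]
      exact (hT.map M).dotOrthogonal fun u hu =>
        (finrank_map_of_disjoint_ker (hM u hu)).trans (hk u hu)
    obtain ⟨S, hS, rfl⟩ := hgen v hv l (mem_dotOrthogonal_map_affineTangentSpace.2 hl)
    rw [eval_evalField]
    refine mem_vanishingIdeal_iff_eval.1
      (mem_vanishingIdeal_of_forall_eval_ne_zero hgj fun u hu hgu => ?_) v hv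
    rw [← eval_evalField]
    refine mem_vanishingIdeal_iff_eval.1 hf _ ⟨_, Set.mem_image_of_mem _ hu, ?_⟩
    refine (mem_conormalSpace_image_iff (hM u hu) (by rw [hk u hu, hcard]) fun hbot => hgu ?_).2
      (mem_dotOrthogonal_map_affineTangentSpace.1 (hS u hu))
    rw [eval_compMulVec]
    exact congrFun ((Submodule.eq_bot_iff _).1 hbot _ (gradient_mem_conormalSpace hg _)) j
  · rintro l ⟨_, ⟨v, hv, rfl⟩, hl⟩
    exact ⟨v, hv, vecMul_mem_conormalSpace hl⟩

end LinearProjection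

section ProjectiveSets

theorem exists_rep_mk_eq_smul {K E : Type*} [DivisionRing K] [AddCommGroup E] [Module K E] {u : E}
    (hu : u ≠ 0) : ∃ c : K, c ≠ 0 ∧ (Projectivization.mk K u hu).rep = c • u := by
  obtain ⟨a, ha⟩ := Projectivization.exists_smul_eq_mk_rep K u hu
  exact ⟨a, a.ne_zero, ha.symm⟩

theorem eval_rep_mk_eq_zero_iff {σ K : Type*} [Field K] {f : MvPolynomial σ K} {d : ℕ}
    (hf : f.IsHomogeneous d) {u : σ → K} (hu : u ≠ 0) :
    eval (Projectivization.mk K u hu).rep f = 0 ↔ eval u f = 0 := by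
  obtain ⟨c, hc, hrep⟩ := exists_rep_mk_eq_smul (K := K) hu
  rw [hrep, eval_smul_of_isHomogeneous hf, mul_eq_zero, or_iff_right (pow_ne_zero _ hc)]

variable {n : ℕ} {X : Set (PP n)}

theorem rep_mem_cone_iff {P : PP n} : P.rep ∈ cone X ↔ P ∈ X := by
  simp [cone, P.rep_nonzero]

theorem zero_notMem_cone : 0 ∉ cone X :=
  fun ⟨h, _⟩ => h rfl

theorem isConical_cone : IsConical (cone X) := by
  rintro v ⟨hv, hX⟩ c hc
  refine ⟨smul_ne_zero hc hv, ?_⟩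
  rwa [(Projectivization.mk_eq_mk_iff' ℂ _ _ _ hv).2 ⟨c, rfl⟩]

theorem mem_vanishingIdeal_cone_iff {f : MvPolynomial (Fin (n + 1)) ℂ} {d : ℕ}
    (hf : f.IsHomogeneous d) :
    f ∈ vanishingIdeal ℂ (cone X) ↔ ∀ P ∈ X, eval P.rep f = 0 := by
  rw [mem_vanishingIdeal_iff_eval]
  refine ⟨fun h P hP => h _ (rep_mem_cone_iff.2 hP), fun h v ⟨hv, hX⟩ => ?_⟩
  exact (eval_rep_mk_eq_zero_iff hf hv).1 (h _ hX)

theorem isClosed_hypersurface {f : MvPolynomial (Fin (n + 1)) ℂ} {d : ℕ}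
    (hf : f.IsHomogeneous d) : IsClosed (hypersurface f) :=
  ⟨TopologicalSpace.isOpen_generateFrom_of_mem ⟨f, d, hf, rfl⟩⟩

theorem isTopologicalBasis_compl_hypersurface : TopologicalSpace.IsTopologicalBasis
    {U : Set (PP n) | ∃ (f : MvPolynomial (Fin (n + 1)) ℂ) (d : ℕ), f.IsHomogeneous d ∧
      U = (hypersurface f)ᶜ} where
  exists_subset_inter := by
    rintro _ ⟨f, d, hf, rfl⟩ _ ⟨g, e, hg, rfl⟩ P hP
    have hfg : (hypersurface (f * g))ᶜ = (hypersurface f)ᶜ ∩ (hypersurface g)ᶜ := by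
      ext Q
      simp [hypersurface]
    exact ⟨_, ⟨f * g, d + e, hf.mul hg, rfl⟩, hfg ▸ hP, hfg.subset⟩
  sUnion_eq := Set.eq_univ_of_forall fun P =>
    ⟨_, ⟨1, 0, isHomogeneous_one _ _, rfl⟩, by simp [hypersurface]⟩
  eq_generateFrom := rfl

theorem mem_closure_of_forall_isHomogeneous {S : Set (PP n)} {P : PP n}
    (h : ∀ (f : MvPolynomial (Fin (n + 1)) ℂ) (d : ℕ), f.IsHomogeneous d →
      f ∈ vanishingIdeal ℂ (cone S) → eval P.rep f = 0) : P ∈ closure S := by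
  rw [isTopologicalBasis_compl_hypersurface.mem_closure_iff]
  rintro _ ⟨f, d, hf, rfl⟩ hP
  by_contra hempty
  refine hP (h f d hf ((mem_vanishingIdeal_cone_iff hf).2 fun Q hQ => ?_))
  by_contra hQf
  exact hempty ⟨Q, hQf, hQ⟩

theorem exists_mem_vanishingIdeal_cone_eval_ne_zero (hX : IsClosed X) {x : Fin (n + 1) → ℂ}
    (hx : x ≠ 0) (hxX : x ∉ cone X) : ∃ f ∈ vanishingIdeal ℂ (cone X), eval x f ≠ 0 := by
  by_contra! h
  refine hxX ⟨hx, hX.closure_subset (mem_closure_of_forall_isHomogeneous fun f d hf hfX => ?_)⟩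
  exact (eval_rep_mk_eq_zero_iff hf hx).2 (h f hfX)

theorem isPrime_vanishingIdeal_cone (hX : IsIrreducible X) :
    (vanishingIdeal ℂ (cone X)).IsPrime := by
  obtain ⟨P, hP⟩ := hX.nonempty
  refine isPrime_vanishingIdeal isConical_cone ⟨_, rep_mem_cone_iff.2 hP⟩ ?_
  intro f g d e hf hg hfg
  rw [mem_vanishingIdeal_cone_iff hf, mem_vanishingIdeal_cone_iff hg]
  by_contra! ⟨⟨Q, hQ, hQf⟩, R, hR, hRg⟩
  obtain ⟨S, hS, hSf, hSg⟩ := hX.2 _ _ (isClosed_hypersurface hf).isOpen_compl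
    (isClosed_hypersurface hg).isOpen_compl ⟨Q, hQ, hQf⟩ ⟨R, hR, hRg⟩
  have hSfg := (mem_vanishingIdeal_cone_iff (hf.mul hg)).1 hfg S hS
  rw [map_mul, mul_eq_zero] at hSfg
  exact hSfg.elim hSf hSg

theorem tangentSpace_eq_affineTangentSpace (P : PP n) :
    tangentSpace X P = affineTangentSpace (cone X) P.rep :=
  Submodule.ext fun _ => mem_affineTangentSpace.symm

theorem IsSmoothIrreducibleCurve.finrank_affineTangentSpace (hX : IsSmoothIrreducibleCurve X)
    {v : Fin (n + 1) → ℂ} (hv : v ∈ cone X) :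
    Module.finrank ℂ (affineTangentSpace (cone X) v) = 2 := by
  obtain ⟨hv0, hvX⟩ := hv
  obtain ⟨c, hc, hrep⟩ := exists_rep_mk_eq_smul (K := ℂ) hv0
  rw [← affineTangentSpace_smul isConical_cone c hc, ← hrep, ← tangentSpace_eq_affineTangentSpace]
  exact (hX.smooth _ hvX).2

theorem IsSmoothIrreducibleCurve.exists_dual_equation {X : Set (PP 3)}
    (hX : IsSmoothIrreducibleCurve X) (hplane : ¬IsPlanar X) :
    ∃ Φ : MvPolynomial (Fin 4) ℂ, Φ.IsHomogeneous Φ.totalDegree ∧ Prime Φ ∧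
      ∀ h, h ∈ dualCone (cone X) ↔ eval h Φ = 0 := by
  have := isPrime_vanishingIdeal_cone hX.irreducible
  have hT : ∀ v ∈ cone X, Module.finrank ℂ (affineTangentSpace (cone X) v) = 2 :=
    fun _ => hX.finrank_affineTangentSpace
  obtain ⟨Φ, hΦ, hprime, hspan⟩ := exists_prime_vanishingIdeal_dualCone_eq_span isConical_cone hT
    (by simp) fun h hh => by
      by_contra! hX0
      exact hplane ⟨h, hh, fun P hP => hX0 _ (rep_mem_cone_iff.2 hP)⟩
  refine ⟨Φ, hΦ, hprime, fun h => ⟨fun hh => ?_, fun hh => ?_⟩⟩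
  · exact mem_vanishingIdeal_iff_eval.1 (hspan ▸ Ideal.mem_span_singleton_self Φ) h hh
  · refine mem_dualCone_of_forall_eval_eq_zero (k := 2) isConical_cone zero_notMem_cone
      (fun _ => exists_mem_vanishingIdeal_cone_eval_ne_zero hX.closed)
      (fun v hv => by rw [finrank_conormalSpace, hT v hv, Fintype.card_fin]) fun D hD => ?_
    obtain ⟨q, rfl⟩ := Ideal.mem_span_singleton.1 (hspan ▸ hD)
    rw [map_mul, hh, zero_mul]

end ProjectiveSets

section PlaneSections

theorem exists_vecMul_eq_of_forall_mulVec_eq_zero {σ τ K : Type*} [Fintype σ] [Fintype τ]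
    [Field K] {M : Matrix τ σ K} {h : σ → K} (hM : ∀ w, M *ᵥ w = 0 → h ⬝ᵥ w = 0) :
    ∃ l, l ᵥ* M = h := by
  suffices h ∈ LinearMap.range M.vecMulLinear from this
  rw [← dotOrthogonal_dotOrthogonal (LinearMap.range M.vecMulLinear), mem_dotOrthogonal]
  intro w hw
  rw [dotProduct_comm]
  refine hM w (dotProduct_eq_zero _ fun l => ?_)
  rw [dotProduct_comm, Matrix.dotProduct_mulVec]
  exact mem_dotOrthogonal.1 hw _ ⟨l, rfl⟩

theorem restrictLine_compMulVec {m n R : Type*} [Fintype n] [CommRing R] (M : Matrix m n R)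
    (f : MvPolynomial m R) (u v : n → R) :
    restrictLine u v (compMulVec M f) = restrictLine (M *ᵥ u) (M *ᵥ v) f := by
  have h : (restrictLine u v).comp (compMulVec M) = restrictLine (M *ᵥ u) (M *ᵥ v) := by
    ext i : 1
    simp [restrictLine, compMulVec, Matrix.toMvPolynomial, aeval_monomial, Matrix.mulVec,
      dotProduct, mul_add, Finset.sum_add_distrib, Finset.sum_mul, mul_assoc]
  rw [← h]
  rfl

theorem squarefree_compMulVec {σ τ K : Type*} [Fintype τ] [Field K] {M : Matrix σ τ K}
    {f : MvPolynomial σ K} (hf : f.IsHomogeneous f.totalDegree) {u v : τ → K}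
    (hv : eval (M *ᵥ v) f ≠ 0) (hsep : (restrictLine (M *ᵥ u) (M *ᵥ v) f).Separable) :
    Squarefree (compMulVec M f) := by
  rw [← restrictLine_compMulVec] at hsep
  refine squarefree_of_squarefree_restrictLine ?_ hsep.squarefree
  rw [restrictLine_compMulVec, natDegree_restrictLine hf hv]
  exact (isHomogeneous_compMulVec M hf).totalDegree_le

end PlaneSections

section EquationUnique

theorem dvd_of_forall_eval_eq_zero {σ K : Type*} [Finite σ] [Field K] [IsAlgClosed K]
    {f g : MvPolynomial σ K} (hf : Squarefree f) (h : ∀ v, eval v f = 0 → eval v g = 0) :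
    f ∣ g := by
  have hrad : (Ideal.span {f}).IsRadical :=
    isRadical_iff_span_singleton.1 ((isRadical_iff_squarefree_of_ne_zero hf.ne_zero).2 hf)
  rw [← Ideal.mem_span_singleton, ← hrad.radical,
    ← vanishingIdeal_zeroLocus_eq_radical (K := K), mem_vanishingIdeal_iff_eval]
  intro v hv
  exact h v (by simpa using hv f (Ideal.mem_span_singleton_self f))

variable {n : ℕ} {f g : MvPolynomial (Fin (n + 1)) ℂ} {d e : ℕ}

theorem eval_zero_of_hypersurface_nonempty (hf : f.IsHomogeneous d) (hf0 : f ≠ 0)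
    (hne : (hypersurface f).Nonempty) : eval 0 f = 0 := by
  obtain ⟨P, hP⟩ := hne
  have hd : d ≠ 0 := by
    rintro rfl
    rw [← totalDegree_zero_iff_isHomogeneous, totalDegree_eq_zero_iff_eq_C] at hf
    rw [hf] at hP hf0
    exact hf0 (by rw [(eval_C _).symm.trans hP, C_0])
  have h := eval_smul_of_isHomogeneous hf 0 (0 : Fin (n + 1) → ℂ)
  rwa [zero_smul, zero_pow hd, zero_mul] at h

theorem dvd_of_hypersurface_eq (hf : f.IsHomogeneous d) (hg : g.IsHomogeneous e)
    (hfs : Squarefree f) (hg0 : g ≠ 0) (hne : (hypersurface g).Nonempty)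
    (h : hypersurface f = hypersurface g) : f ∣ g := by
  refine dvd_of_forall_eval_eq_zero hfs fun v hv => ?_
  obtain rfl | hv0 := eq_or_ne v 0
  · exact eval_zero_of_hypersurface_nonempty hg hg0 hne
  · refine (eval_rep_mk_eq_zero_iff hg hv0).1 (h.subset ?_)
    exact (eval_rep_mk_eq_zero_iff hf hv0).2 hv

theorem exists_eq_C_mul_of_hypersurface_eq (hf : f.IsHomogeneous d) (hg : g.IsHomogeneous e)
    (hfs : Squarefree f) (hgs : Squarefree g) (hne : (hypersurface g).Nonempty)
    (h : hypersurface f = hypersurface g) : ∃ c : ℂ, c ≠ 0 ∧ f = C c * g := by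
  obtain ⟨u, hu⟩ := associated_of_dvd_dvd
    (dvd_of_hypersurface_eq hg hf hgs hfs.ne_zero (h ▸ hne) h.symm)
    (dvd_of_hypersurface_eq hf hg hfs hgs.ne_zero hne h)
  obtain ⟨c, hc, huc⟩ := isUnit_iff_eq_C_of_isReduced.1 u.isUnit
  exact ⟨c, hc.ne_zero, by rw [← hu, huc, mul_comm]⟩

end EquationUnique

section PlaneCurve

variable {Y : Set (PP 2)}

theorem exists_isSmoothPoint_tangent_iff
    (hY : ∀ v ∈ cone Y, Module.finrank ℂ (conormalSpace (cone Y) v) ≤ 1) {l : PP 2} :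
    (∃ P, IsSmoothPoint Y P ∧ ∀ w ∈ tangentSpace Y P, l.rep ⬝ᵥ w = 0) ↔
      l.rep ∈ dualCone (cone Y) := by
  simp only [IsSmoothPoint, tangentSpace_eq_affineTangentSpace, ← mem_conormalSpace_iff]
  refine ⟨fun ⟨P, hP, hl⟩ => ⟨P.rep, rep_mem_cone_iff.2 hP.1, hl⟩, ?_⟩
  rintro ⟨v, hv, hl⟩
  obtain ⟨hv0, hvY⟩ := id hv
  obtain ⟨c, hc, hrep⟩ := exists_rep_mk_eq_smul (K := ℂ) hv0
  rw [← conormalSpace_smul isConical_cone c hc, ← hrep] at hl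
  refine ⟨_, ⟨hvY, ?_⟩, hl⟩
  have hle := hY _ (rep_mem_cone_iff.2 hvY)
  have hpos := Submodule.one_le_finrank_iff.2 ((Submodule.ne_bot_iff _).2 ⟨_, hl, l.rep_nonzero⟩)
  rw [finrank_conormalSpace, Fintype.card_fin] at hle hpos
  rw [tangentSpace_eq_affineTangentSpace]
  omega

theorem dualCurve_eq_hypersurface {Ψ : MvPolynomial (Fin 3) ℂ} {d : ℕ}
    (hY : ∀ v ∈ cone Y, Module.finrank ℂ (conormalSpace (cone Y) v) ≤ 1) (hΨ : Ψ.IsHomogeneous d)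
    (hdual : vanishingIdeal ℂ (dualCone (cone Y)) = vanishingIdeal ℂ {l | eval l Ψ = 0}) :
    dualCurve Y = hypersurface Ψ := by
  have hΨY : Ψ ∈ vanishingIdeal ℂ (dualCone (cone Y)) :=
    hdual ▸ mem_vanishingIdeal_iff_eval.2 fun _ hl => hl
  refine (closure_minimal (fun l hl => ?_) (isClosed_hypersurface hΨ)).antisymm fun l hl => ?_
  · exact mem_vanishingIdeal_iff_eval.1 hΨY _ ((exists_isSmoothPoint_tangent_iff hY).1 hl)
  · refine mem_closure_of_forall_isHomogeneous fun f e _ hfS => ?_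
    obtain ⟨j, hj⟩ := Function.ne_iff.1 l.rep_nonzero
    -- The factor `X j` makes the product vanish at the vertex of the dual cone too.
    have hXf : X j * f ∈ vanishingIdeal ℂ (dualCone (cone Y)) :=
      mem_vanishingIdeal_iff_eval.2 fun k hk => by
        rw [map_mul, eval_X, mul_eq_zero, or_iff_not_imp_left]
        intro hkj
        have hk0 : k ≠ 0 := fun h => hkj (congrFun h j)
        refine mem_vanishingIdeal_iff_eval.1 hfS k ⟨hk0, ?_⟩
        obtain ⟨c, hc, hrep⟩ := exists_rep_mk_eq_smul (K := ℂ) hk0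
        exact (exists_isSmoothPoint_tangent_iff hY).2 (hrep ▸ isConical_totalSpace k hk c hc)
    have hl0 := mem_vanishingIdeal_iff_eval.1 (hdual ▸ hXf) l.rep hl
    rw [map_mul, eval_X] at hl0
    exact (mul_eq_zero.1 hl0).resolve_left hj

end PlaneCurve

section Determinants

variable {n : ℕ} {R : Type*} [CommRing R]

theorem sum_det_succAbove_smul_eq_zero (v : Fin (n + 1) → Fin n → R) :
    ∑ i : Fin (n + 1),
      ((-1) ^ (i : ℕ) * (Matrix.of fun j => v (i.succAbove j)).det) • v i = 0 := by
  ext t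
  let N : Matrix (Fin (n + 1)) (Fin (n + 1)) R := Matrix.of fun i => Fin.cons (v i t) (v i)
  have hN : N.det = 0 := Matrix.det_zero_of_column_eq (Fin.succ_ne_zero t) fun i => by simp [N]
  rw [Matrix.det_succ_column_zero] at hN
  rw [Finset.sum_apply, Pi.zero_apply, ← hN]
  refine Finset.sum_congr rfl fun i _ => ?_
  rw [Pi.smul_apply, smul_eq_mul, mul_right_comm]
  rfl

/-- The maximal minors of `M` with alternating signs: the generalised cross product of the rows. -/
def signedMinors (M : Matrix (Fin n) (Fin (n + 1)) R) : Fin (n + 1) → R :=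
  fun i => (-1) ^ (i : ℕ) * (M.submatrix id i.succAbove).det

theorem dotProduct_signedMinors (M : Matrix (Fin n) (Fin (n + 1)) R) (x : Fin (n + 1) → R) :
    x ⬝ᵥ signedMinors M = (Matrix.of (Matrix.vecCons x M)).det := by
  rw [Matrix.det_succ_row_zero]
  refine Finset.sum_congr rfl fun i _ => ?_
  rw [signedMinors, mul_left_comm, ← mul_assoc]
  rfl

theorem mulVec_signedMinors (M : Matrix (Fin n) (Fin (n + 1)) R) : M *ᵥ signedMinors M = 0 := by
  ext i
  exact (dotProduct_signedMinors M (M i)).trans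
    (Matrix.det_zero_of_row_eq (Fin.succ_ne_zero i).symm rfl)

theorem exists_signedMinors_eq_smul {K : Type*} [Field K] {M : Matrix (Fin n) (Fin (n + 1)) K}
    {o : Fin (n + 1) → K} (ho : o ≠ 0) (hM : LinearMap.ker M.mulVecLin = K ∙ o) :
    ∃ c : K, c ≠ 0 ∧ signedMinors M = c • o := by
  have hker w (hw : M *ᵥ w = 0) : ∃ c : K, c • o = w :=
    Submodule.mem_span_singleton.1 (hM ▸ LinearMap.mem_ker.2 hw)
  obtain ⟨c, hc⟩ := hker _ (mulVec_signedMinors M)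
  refine ⟨c, ?_, hc.symm⟩
  rintro rfl
  obtain ⟨k, hk⟩ := Function.ne_iff.1 ho
  have hdet : (Matrix.of (Matrix.vecCons (Pi.single k 1) M)).det = 0 := by
    rw [← dotProduct_signedMinors, ← hc, zero_smul, dotProduct_zero]
  obtain ⟨w, hw0, hw⟩ := Matrix.exists_mulVec_eq_zero_iff.2 hdet
  obtain ⟨b, rfl⟩ := hker w (funext fun i => congrFun hw i.succ)
  have hbk : b * o k = 0 := (single_one_dotProduct k (b • o)).symm.trans (congrFun hw 0)
  exact hw0 (by rw [(mul_eq_zero.1 hbk).resolve_right hk, zero_smul])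

theorem det_smul_add_det_smul_add_det_smul (a b c x y : Fin 4 → R) :
    (Matrix.of ![b, c, x, y]).det • a + (Matrix.of ![c, a, x, y]).det • b +
        (Matrix.of ![a, b, x, y]).det • c =
      (Matrix.of ![x, a, b, c]).det • y - (Matrix.of ![y, a, b, c]).det • x := by
  have hswap : (Matrix.of ![c, a, x, y]).det = -(Matrix.of ![a, c, x, y]).det := by
    have hrows : Matrix.of ![c, a, x, y] =
        (Matrix.of ![a, c, x, y]).submatrix (Equiv.swap 0 1) id :=
      Matrix.ext fun i j => by fin_cases i <;> rfl
    rw [hrows, Matrix.det_permute, Equiv.Perm.sign_swap (by decide)]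
    simp
  have hrotate (z : Fin 4 → R) :
      (Matrix.of ![z, a, b, c]).det = -(Matrix.of ![a, b, c, z]).det := by
    have hrows : Matrix.of ![a, b, c, z] =
        (Matrix.of ![z, a, b, c]).submatrix (finRotate 4) id :=
      Matrix.ext fun i j => by fin_cases i <;> rfl
    rw [hrows, Matrix.det_permute, sign_finRotate]
    simp
  have hrows (i : Fin 5) : (fun j => ![a, b, c, x, y] (i.succAbove j)) =
    ![![b, c, x, y], ![a, c, x, y], ![a, b, x, y], ![a, b, c, y], ![a, b, c, x]] i := by
    ext j
    fin_cases i <;> fin_cases j <;> rfl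
  have h : (Matrix.of ![b, c, x, y]).det • a + -((Matrix.of ![a, c, x, y]).det • b) +
      (Matrix.of ![a, b, x, y]).det • c + -((Matrix.of ![a, b, c, y]).det • x) +
      (Matrix.of ![a, b, c, x]).det • y = 0 := by
    simpa [hrows, Fin.sum_univ_five, pow_succ] using sum_det_succAbove_smul_eq_zero ![a, b, c, x, y]
  rw [hswap, hrotate, hrotate]
  linear_combination (norm := module) h

end Determinants

section FundamentalMatrix

theorem fundamentalMatrix_vecMul (M₁ M₂ : Matrix (Fin 3) (Fin 4) ℂ) (p : Fin 3 → ℂ) :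
    (fundamentalMatrix M₁ M₂ *ᵥ p) ᵥ* M₂ = (p ⨯₃ (M₁ *ᵥ signedMinors M₂)) ᵥ* M₁ := by
  have hm (i) : (M₁ *ᵥ signedMinors M₂) i = (Matrix.of ![M₁ i, M₂ 0, M₂ 1, M₂ 2]).det := by
    refine (dotProduct_signedMinors M₂ (M₁ i)).trans (congrArg Matrix.det ?_)
    ext i j
    fin_cases i <;> rfl
  have hF (i j) : fundamentalMatrix M₁ M₂ i j =
    (Matrix.of ![M₂ (i + 1), M₂ (i + 2), M₁ (j + 1), M₁ (j + 2)]).det := rfl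
  have hadd : (1 : Fin 3) + 1 = 2 ∧ (1 : Fin 3) + 2 = 0 ∧ (2 : Fin 3) + 1 = 0 ∧
    (2 : Fin 3) + 2 = 1 := by decide
  have hray (x y) := det_smul_add_det_smul_add_det_smul (M₂ 0) (M₂ 1) (M₂ 2) x y
  rw [Matrix.vecMul_eq_sum, Matrix.vecMul_eq_sum, cross_apply, hm, hm, hm]
  simp only [Matrix.mulVec, dotProduct, Fin.sum_univ_three, hF, zero_add, hadd,
    Matrix.cons_val_zero, Matrix.cons_val_one, Matrix.cons_val]
  linear_combination (norm := module) p 0 • hray (M₁ 1) (M₁ 2) + p 1 • hray (M₁ 2) (M₁ 0) +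
    p 2 • hray (M₁ 0) (M₁ 1)

theorem IsProjectionFrom.ker_eq {M : Matrix (Fin 3) (Fin 4) ℂ} {O : PP 3}
    (hM : IsProjectionFrom M O) : LinearMap.ker M.mulVecLin = ℂ ∙ O.rep :=
  Eq.trans hM O.submodule_eq

/-- Both sides are the plane through the two centres and the optical ray of `p`. -/
theorem exists_fundamentalMatrix_vecMul {M₁ M₂ : Matrix (Fin 3) (Fin 4) ℂ} {O : PP 3}
    (hM₂ : IsProjectionFrom M₂ O) {e : Fin 3 → ℂ} (he : IsEpipole e M₁ O) :
    ∃ κ : ℂ, κ ≠ 0 ∧ ∀ p, (fundamentalMatrix M₁ M₂ *ᵥ p) ᵥ* M₂ = κ • ((e ⨯₃ p) ᵥ* M₁) := by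
  obtain ⟨c, hc, hminors⟩ := exists_signedMinors_eq_smul O.rep_nonzero hM₂.ker_eq
  obtain ⟨he0, v, hv, rfl⟩ := he
  rw [Projectivization.submodule_eq, Submodule.mem_span_singleton] at hv
  obtain ⟨b, rfl⟩ := hv
  have hb : b ≠ 0 := by
    rintro rfl
    exact he0 (by rw [zero_smul, Matrix.mulVec_zero])
  refine ⟨-c / b, div_ne_zero (neg_ne_zero.2 hc) hb, fun p => ?_⟩
  rw [fundamentalMatrix_vecMul, hminors, Matrix.mulVec_smul, Matrix.mulVec_smul, ← cross_anticomm,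
    map_smul, map_smul, LinearMap.smul_apply, LinearMap.smul_apply, Matrix.neg_vecMul,
    Matrix.smul_vecMul, Matrix.smul_vecMul, smul_smul, div_mul_cancel₀ _ hb, neg_smul]

end FundamentalMatrix

universe u

/-- A centre `o` of projection is generic for the cone `V` and the equation `Φ` of its dual
hypersurface if `o` lies on no tangent space and some pencil of hyperplanes through `o` meets
`Φ = 0` transversally. Then the dual of the projection of `V` from `o` is the reduced section of
`Φ = 0` by the hyperplanes through `o`. -/
structure IsGenericCentre {σ K : Type u} [Fintype σ] [Field K] (V : Set (σ → K))
    (Φ : MvPolynomial σ K) (o : σ → K) : Prop where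
  notMem_affineTangentSpace : ∀ v ∈ V, o ∉ affineTangentSpace V v
  exists_separable : ∃ u v, u ⬝ᵥ o = 0 ∧ v ⬝ᵥ o = 0 ∧ eval v Φ ≠ 0 ∧
    (restrictLine u v Φ).Separable

section Projection

variable {X : Set (PP 3)} {M : Matrix (Fin 3) (Fin 4) ℂ} {O : PP 3}

theorem cone_projectedCurve (hM : ∀ v ∈ cone X, M *ᵥ v ≠ 0) :
    cone (projectedCurve M X) = M.mulVecLin '' cone X := by
  ext w
  constructor
  · rintro ⟨hw, P, hP, hMP, h⟩
    obtain ⟨a, rfl⟩ := (Projectivization.mk_eq_mk_iff' ℂ _ _ hw hMP).1 h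
    have ha : a ≠ 0 := by
      rintro rfl
      exact hw (zero_smul _ _)
    exact ⟨a • P.rep, isConical_cone _ (rep_mem_cone_iff.2 hP) a ha, map_smul M.mulVecLin _ _⟩
  · rintro ⟨v, ⟨hv0, hvX⟩, rfl⟩
    have hMv := hM v ⟨hv0, hvX⟩
    have hMP := hM _ (rep_mem_cone_iff.2 hvX)
    obtain ⟨a, -, hrep⟩ := exists_rep_mk_eq_smul (K := ℂ) hv0
    refine ⟨hMv, _, hvX, hMP, .symm ((Projectivization.mk_eq_mk_iff' ℂ _ _ hMP hMv).2 ⟨a, ?_⟩)⟩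
    rw [hrep, Matrix.mulVec_smul]

theorem IsProjectionFrom.disjoint_ker (hM : IsProjectionFrom M O) {E : Submodule ℂ (Fin 4 → ℂ)}
    (hO : O.rep ∉ E) : Disjoint E (LinearMap.ker M.mulVecLin) := by
  rw [hM.ker_eq, Submodule.disjoint_span_singleton' O.rep_nonzero]
  exact hO

theorem IsProjectionFrom.exists_vecMul_eq (hM : IsProjectionFrom M O) {h : Fin 4 → ℂ}
    (hO : h ⬝ᵥ O.rep = 0) : ∃ l, l ᵥ* M = h := by
  refine exists_vecMul_eq_of_forall_mulVec_eq_zero fun w hw => ?_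
  obtain ⟨a, rfl⟩ := Submodule.mem_span_singleton.1 (hM.ker_eq ▸ LinearMap.mem_ker.2 hw)
  rw [dotProduct_smul, hO, smul_zero]

variable {Φ : MvPolynomial (Fin 4) ℂ}

theorem IsProjectionFrom.squarefree_compMulVec_transpose (hM : IsProjectionFrom M O)
    (hΦ : Φ.IsHomogeneous Φ.totalDegree) (hO : IsGenericCentre (cone X) Φ O.rep) :
    Squarefree (compMulVec Mᵀ Φ) := by
  obtain ⟨u, v, hu, hv, hvΦ, hsep⟩ := hO.exists_separable
  obtain ⟨l, rfl⟩ := hM.exists_vecMul_eq hu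
  obtain ⟨m, rfl⟩ := hM.exists_vecMul_eq hv
  simp only [← Matrix.mulVec_transpose] at hvΦ hsep
  exact squarefree_compMulVec hΦ hvΦ hsep

theorem IsProjectionFrom.dualCurve_projectedCurve (hM : IsProjectionFrom M O)
    (hX : IsSmoothIrreducibleCurve X) (hO : IsGenericCentre (cone X) Φ O.rep)
    (hΦ : Φ.IsHomogeneous Φ.totalDegree) (hdual : ∀ h, h ∈ dualCone (cone X) ↔ eval h Φ = 0) :
    dualCurve (projectedCurve M X) = hypersurface (compMulVec Mᵀ Φ) := by
  have := isPrime_vanishingIdeal_cone hX.irreducible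
  have hker v (hv : v ∈ cone X) := hM.disjoint_ker (hO.notMem_affineTangentSpace v hv)
  have hcone : cone (projectedCurve M X) = M.mulVecLin '' cone X :=
    cone_projectedCurve fun v hv h0 => zero_notMem_cone <|
      Submodule.disjoint_def.1 (hker v hv) v (self_mem_affineTangentSpace isConical_cone hv) h0 ▸ hv
  refine dualCurve_eq_hypersurface ?_ (isHomogeneous_compMulVec _ hΦ) ?_
  · rw [hcone]
    rintro _ ⟨v, hv, rfl⟩
    refine (Submodule.finrank_mono conormalSpace_image_le).trans ?_
    rw [finrank_dotOrthogonal_map_affineTangentSpace (hker v hv), hX.finrank_affineTangentSpace hv,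
      Fintype.card_fin]
  · rw [hcone, vanishingIdeal_dualCone_image isConical_cone zero_notMem_cone
      (fun v hv => hX.finrank_affineTangentSpace hv) hker (Fintype.card_fin 3)]
    simp only [hdual, eval_compMulVec, Matrix.mulVec_transpose]

theorem IsProjectionFrom.hypersurface_compMulVec_transpose_nonempty (hM : IsProjectionFrom M O)
    (hX : IsSmoothIrreducibleCurve X) (hΦ : Φ.IsHomogeneous Φ.totalDegree)
    (hdual : ∀ h, h ∈ dualCone (cone X) ↔ eval h Φ = 0) :
    (hypersurface (compMulVec Mᵀ Φ)).Nonempty := by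
  obtain ⟨P, hP⟩ := hX.irreducible.nonempty
  have hv : P.rep ∈ cone X := rep_mem_cone_iff.2 hP
  obtain ⟨h, hh, hh0, hhO⟩ := exists_mem_ne_zero_dotProduct_eq_zero
    (E := conormalSpace (cone X) P.rep) (by
      rw [finrank_conormalSpace, hX.finrank_affineTangentSpace hv, Fintype.card_fin]
      norm_num) O.rep
  obtain ⟨l, rfl⟩ := hM.exists_vecMul_eq hhO
  have hl : l ≠ 0 := by
    rintro rfl
    exact hh0 (Matrix.zero_vecMul M)
  refine ⟨Projectivization.mk ℂ l hl, ?_⟩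
  refine (eval_rep_mk_eq_zero_iff (isHomogeneous_compMulVec _ hΦ) hl).2 ?_
  rw [eval_compMulVec, Matrix.mulVec_transpose]
  exact (hdual _).1 ⟨_, hv, hh⟩

theorem IsEquationOf.exists_eq_C_mul {φ : MvPolynomial (Fin 3) ℂ}
    (hφ : IsEquationOf φ (dualCurve (projectedCurve M X))) (hX : IsSmoothIrreducibleCurve X)
    (hM : IsProjectionFrom M O) (hO : IsGenericCentre (cone X) Φ O.rep)
    (hΦ : Φ.IsHomogeneous Φ.totalDegree) (hdual : ∀ h, h ∈ dualCone (cone X) ↔ eval h Φ = 0) :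
    ∃ c : ℂ, c ≠ 0 ∧ φ = C c * compMulVec Mᵀ Φ := by
  obtain ⟨⟨d, hd⟩, hsq, hcurve⟩ := hφ
  exact exists_eq_C_mul_of_hypersurface_eq hd (isHomogeneous_compMulVec _ hΦ) hsq
    (hM.squarefree_compMulVec_transpose hΦ hO)
    (hM.hypersurface_compMulVec_transpose_nonempty hX hΦ hdual)
    (hcurve.symm.trans (hM.dualCurve_projectedCurve hX hO hΦ hdual))

end Projection

section GenericPoints

theorem isWeightedHomogeneous_rename {σ τ R N : Type*} [CommSemiring R] [AddCommMonoid N]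
    {f : σ → τ} {w : τ → N} {p : MvPolynomial σ R} {m : N}
    (hp : IsWeightedHomogeneous (w ∘ f) p m) : IsWeightedHomogeneous w (rename f p) m := by
  intro d hd
  obtain ⟨u, rfl, hu⟩ := coeff_rename_ne_zero f p d hd
  rw [← hp hu, Finsupp.weight_apply, Finsupp.weight_apply,
    Finsupp.sum_mapDomain_index (by simp) (by simp [add_smul])]
  rfl

theorem isWeightedHomogeneous_zero_weight {σ R N : Type*} [CommSemiring R] [AddCommMonoid N]
    (p : MvPolynomial σ R) : IsWeightedHomogeneous (fun _ => 0 : σ → N) p 0 := by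
  intro d _
  simp [Finsupp.weight_apply]

theorem compl_hypersurface_nonempty {n d : ℕ} {f : MvPolynomial (Fin (n + 1)) ℂ}
    (hf : f.IsHomogeneous d) (hf0 : f ≠ 0) : (hypersurface f)ᶜ.Nonempty := by
  obtain ⟨x, hx⟩ : ∃ x, eval x (X 0 * f) ≠ 0 := by
    by_contra! h
    exact mul_ne_zero (X_ne_zero 0) hf0 (MvPolynomial.funext fun x => by rw [h, map_zero])
  rw [map_mul, eval_X] at hx
  have hx0 : x ≠ 0 := fun h => left_ne_zero_of_mul hx (congrFun h 0)
  exact ⟨_, mt (eval_rep_mk_eq_zero_iff hf hx0).1 (right_ne_zero_of_mul hx)⟩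

theorem isOpen_compl_hypersurface_prod {f g : MvPolynomial (Fin 4) ℂ} {d e : ℕ}
    (hf : f.IsHomogeneous d) (hg : g.IsHomogeneous e) :
    IsOpen[zariskiProd] ((hypersurface f)ᶜ ×ˢ (hypersurface g)ᶜ) := by
  refine TopologicalSpace.isOpen_generateFrom_of_mem
    ⟨rename Sum.inl f * rename Sum.inr g, d + 0, 0 + e, .mul ?_ ?_, .mul ?_ ?_, ?_⟩
  · exact isWeightedHomogeneous_rename (by rwa [Sum.elim_comp_inl])
  · exact isWeightedHomogeneous_rename
      (by rw [Sum.elim_comp_inr]; exact isWeightedHomogeneous_zero_weight g)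
  · exact isWeightedHomogeneous_rename
      (by rw [Sum.elim_comp_inl]; exact isWeightedHomogeneous_zero_weight f)
  · exact isWeightedHomogeneous_rename (by rwa [Sum.elim_comp_inr])
  · ext O
    simp [hypersurface, eval_rename]

end GenericPoints

section GenericCentres

theorem exists_homogeneousComponent_eval_ne_zero_imp {σ K : Type*} [Field K] [Infinite K]
    {G : MvPolynomial σ K} (hG : G ≠ 0) : ∃ j, homogeneousComponent j G ≠ 0 ∧
      ∀ v, eval v (homogeneousComponent j G) ≠ 0 → ∃ c : K, c ≠ 0 ∧ eval (c • v) G ≠ 0 := by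
  obtain ⟨j, hj⟩ : ∃ j, homogeneousComponent j G ≠ 0 := by
    by_contra! h
    exact hG ((sum_homogeneousComponent G).symm.trans (Finset.sum_eq_zero fun j _ => h j))
  refine ⟨j, hj, fun v hv => ?_⟩
  by_contra! h
  exact hv (eval_homogeneousComponent_eq_zero h j)

theorem exists_isGenericCentre {σ K : Type u} [Fintype σ] [Field K] [CharZero K]
    {V : Set (σ → K)} [(vanishingIdeal K V).IsPrime] (hV : IsConical V) {i : σ}
    (hi : X i ∉ vanishingIdeal K V) {k : ℕ}
    (hk : ∀ v ∈ V, Module.finrank K (affineTangentSpace V v) = k) (hcard : 2 < Fintype.card σ)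
    (hcardk : 2 * k ≤ Fintype.card σ) {Φ : MvPolynomial σ K}
    (hΦ : Φ.IsHomogeneous Φ.totalDegree) (hprime : Prime Φ) :
    ∃ (H : MvPolynomial σ K) (d : ℕ), H.IsHomogeneous d ∧ H ≠ 0 ∧
      ∀ o, eval o H ≠ 0 → IsGenericCentre V Φ o := by
  have hfinrank v (hv : v ∈ V) : Module.finrank K (conormalSpace V v) = Fintype.card σ - k := by
    rw [finrank_conormalSpace, hk v hv]
  obtain ⟨A, hA0, hA⟩ := exists_mem_vanishingIdeal_totalSpace
    (globallyGenerated_conormalSpace.dotOrthogonal hfinrank) hV hi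
    (affineTangentSpace_smul hV) hk fun v hv => by
      rw [hfinrank v hv]
      omega
  obtain ⟨B, hB0, hB⟩ := exists_separable_orthogonal_line hΦ hprime hcard
  obtain ⟨d, hd, hAB⟩ := exists_homogeneousComponent_eval_ne_zero_imp (mul_ne_zero hA0 hB0)
  refine ⟨_, d, homogeneousComponent_isHomogeneous d _, hd, fun o ho => ?_⟩
  obtain ⟨c, hc, hco⟩ := hAB o ho
  rw [map_mul] at hco
  refine ⟨fun v hv hov => left_ne_zero_of_mul hco ?_, ?_⟩
  · exact mem_vanishingIdeal_iff_eval.1 hA _ ⟨v, hv, Submodule.smul_mem _ c hov⟩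
  · obtain ⟨u, v, hu, hv, hvΦ, hsep⟩ := hB _ (right_ne_zero_of_mul hco)
    rw [dotProduct_smul, smul_eq_zero, or_iff_right hc] at hu hv
    exact ⟨u, v, hu, hv, hvΦ, hsep⟩

end GenericCentres

theorem IsSmoothIrreducibleCurve.exists_isGenericCentre {X : Set (PP 3)}
    (hX : IsSmoothIrreducibleCurve X) {Φ : MvPolynomial (Fin 4) ℂ}
    (hΦ : Φ.IsHomogeneous Φ.totalDegree) (hprime : Prime Φ) :
    ∃ (H : MvPolynomial (Fin 4) ℂ) (d : ℕ), H.IsHomogeneous d ∧ H ≠ 0 ∧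
      ∀ o, eval o H ≠ 0 → IsGenericCentre (cone X) Φ o := by
  have := isPrime_vanishingIdeal_cone hX.irreducible
  obtain ⟨P, hP⟩ := hX.irreducible.nonempty
  obtain ⟨i, hi⟩ := Function.ne_iff.1 P.rep_nonzero
  refine Kruppa.exists_isGenericCentre isConical_cone (i := i) (fun h => hi ?_)
    (fun _ => hX.finrank_affineTangentSpace) (by simp) (by simp) hΦ hprime
  rw [← eval_X (R := ℂ) (f := P.rep) i]
  exact mem_vanishingIdeal_iff_eval.1 h _ (rep_mem_cone_iff.2 hP)

end Kruppa

theorem mainTheorem3 (X : Set (Kruppa.PP 3)) (hX : Kruppa.IsSmoothIrreducibleCurve X)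
    (hXplane : ¬ Kruppa.IsPlanar X) :
    ∃ U : Set (Kruppa.PP 3 × Kruppa.PP 3), IsOpen[Kruppa.zariskiProd] U ∧ U.Nonempty ∧
      ∀ (O₁ O₂ : Kruppa.PP 3), (O₁, O₂) ∈ U →
      ∀ (M₁ M₂ : Matrix (Fin 3) (Fin 4) ℂ),
        Kruppa.IsProjectionFrom M₁ O₁ → Kruppa.IsProjectionFrom M₂ O₂ →
      ∀ (φ₁ φ₂ : MvPolynomial (Fin 3) ℂ),
        Kruppa.IsEquationOf φ₁ (Kruppa.dualCurve (Kruppa.projectedCurve M₁ X)) →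
        Kruppa.IsEquationOf φ₂ (Kruppa.dualCurve (Kruppa.projectedCurve M₂ X)) →
      ∀ e₁ : Fin 3 → ℂ, Kruppa.IsEpipole e₁ M₁ O₂ →
      ∃ c : ℂ, c ≠ 0 ∧ ∀ p : Fin 3 → ℂ,
        MvPolynomial.eval (Kruppa.fundamentalMatrix M₁ M₂ *ᵥ p) φ₂ =
          c * MvPolynomial.eval (e₁ ⨯₃ p) φ₁ := by
  obtain ⟨Φ, hΦ, hprime, hdual⟩ := hX.exists_dual_equation hXplane
  obtain ⟨H, d, hH, hH0, hgeneric⟩ := hX.exists_isGenericCentre hΦ hprime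
  have hne := Kruppa.compl_hypersurface_nonempty hH hH0
  refine ⟨_, Kruppa.isOpen_compl_hypersurface_prod hH hH, hne.prod hne, ?_⟩
  rintro O₁ O₂ ⟨hO₁, hO₂⟩ M₁ M₂ hM₁ hM₂ φ₁ φ₂ hφ₁ hφ₂ e₁ he₁
  obtain ⟨c₁, hc₁, rfl⟩ := hφ₁.exists_eq_C_mul hX hM₁ (hgeneric _ hO₁) hΦ hdual
  obtain ⟨c₂, hc₂, rfl⟩ := hφ₂.exists_eq_C_mul hX hM₂ (hgeneric _ hO₂) hΦ hdual
  obtain ⟨κ, hκ, hF⟩ := Kruppa.exists_fundamentalMatrix_vecMul hM₂ he₁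
  refine ⟨c₂ * κ ^ Φ.totalDegree / c₁, by positivity, fun p => ?_⟩
  simp only [map_mul, MvPolynomial.eval_C, Kruppa.eval_compMulVec, Matrix.mulVec_transpose, hF,
    Kruppa.eval_smul_of_isHomogeneous hΦ]
  field_simp
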